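/- Let $k\in\mathbb N$ and let $\Lambda$ (also written $\mathbb F_\theta^+$) be a single-vertex $k$-graph, i.e. a unital semigroup with a degree homomorphism $d:\Lambda\to\mathbb N^k$ such that whenever $d(w)=p+q$ there are unique $u,v\in\Lambda$ with $w=uv$, $d(u)=p$, $d(v)=q$. Let $\varepsilon_1,\dots,\varepsilon_k$ be the standard generators of $\mathbb N^k$; elements of degree $\varepsilon_i$ are called edges of colour $i$. Assume that the number $m_i$ of edges of colour $i$ is finite and $m_i>1$ for every $1\le i\le k$. Write $m^p=\prod_i m_i^{p_i}$ for $p\in\mathbb Z^k$. Let $\mathcal O_\theta$ be the universal unital C*-algebra generated by a representation $w\mapsto s_w$ of the semigroup $\Lambda$ (with $s_1=1$) such that, for every colour $i$, one has $s_e^*s_f=\delta_{e,f}1$ for edges $e,f$ of colour $i$, and $\sum_{e} s_es_e^*=1$, the sum being over the edges $e$ of colour $i$. Let $\gamma_t$ ($t\in\mathbb T^k$) be the gauge automorphisms, $\gamma_t(s_w)=t^{d(w)}s_w$, let $\mathfrak F=\mathcal O_\theta^\gamma$ be their fixed point algebra (the UHF core), and let $\Phi_0(A)=\int_{\mathbb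 T^k}\gamma_t(A)\,dt$, the integral being with respect to normalized Haar measure. Then $\mathfrak F$ has a unique tracial state $\tau$; put $\omega=\tau\circ\Phi_0$. The modular automorphism group of $\omega$ on $\mathcal O_\theta$ is the action $\sigma$ of $\mathbb R$ with $\sigma_t(s_us_v^*)=m^{it(d(v)-d(u))}s_us_v^*$ for $u,v\in\Lambda$, $t\in\mathbb R$: it is a strongly continuous one-parameter group of automorphisms that preserves $\omega$ and satisfies the modular (KMS) condition, i.e. for all $A,B\in\mathcal O_\theta$ there is a bounded continuous function $F$ on $\{0\le\operatorname{Im}z\le1\}$, analytic in the interior, with $F(t)=\omega(\sigma_t(A)B)$ and $F(t+i)=\omega(B\sigma_t(A))$ for all $t\in\mathbb R$. Let $\mathcal O_\theta^\sigma=\{A\in\mathcal O_\theta:\sigma_t(A)=A\text{ for all }t\in\mathbb R\}\supseteq\mathfrak F$. Suppose that at least one of the following holds: (a) $\Lambda$ has the little pull-back property: whenever $e,f$ are edges of distinct colours, there is at most one pair $(\xi,\eta)\in\Lambda\times\Lambda$ with $e\xi=f\eta$ and $d(e\xi)=d(e)\vee d(f)$; (b) the intrinsic group $G=\{g\in\mathbb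 Z^k: m^g=1\}$ has rank $0$. Then $\mathcal O_\theta^\sigma$ has a unique tracial state, and this tracial state extends $\tau$. -/

import Mathlib

open scoped ENNReal

universe u v

/-- A single-vertex `k`-graph: a `k`-graph (small category with a degree map to `ℕ^k` satisfying
the factorization property) with exactly one object, i.e. a monoid `Λ` with a degree homomorphism
`d : Λ → ℕ^k` and unique factorizations, with finitely many edges of every colour. -/
structure SingleVertexKGraph (k : ℕ) (Λ : Type u) [Monoid Λ] where
  d : Λ → Fin k → ℕ
  d_one : d 1 = 0
  d_mul : ∀ u v : Λ, d (u * v) = d u + d v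
  factorization : ∀ (w : Λ) (p q : Fin k → ℕ), d w = p + q →
    ∃! x : Λ × Λ, w = x.1 * x.2 ∧ d x.1 = p ∧ d x.2 = q
  finite_edges : ∀ i : Fin k, Finite {e : Λ // d e = Pi.single i 1}

namespace SingleVertexKGraph

variable {k : ℕ} {Λ : Type u} [Monoid Λ] (G : SingleVertexKGraph k Λ)

/-- The edges of colour `i`: the elements of degree `ε_i`. -/
abbrev Edge (i : Fin k) : Type u := {e : Λ // G.d e = Pi.single i 1}

noncomputable instance edgeFintype (i : Fin k) : Fintype (G.Edge i) :=
  haveI := G.finite_edges i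
  Fintype.ofFinite _

/-- The number `m_i` of edges of colour `i`. -/
noncomputable def m (i : Fin k) : ℕ := Fintype.card (G.Edge i)

/-- `Λ^min(μ, ν)`: the pairs `(ξ, η)` with `μ ξ = ν η` of degree `d(μ) ∨ d(ν)`. -/
def minExt (μ ν : Λ) : Set (Λ × Λ) :=
  {x | μ * x.1 = ν * x.2 ∧ G.d (μ * x.1) = G.d μ ⊔ G.d ν}

/-- The little pull-back property: `|Λ^min(e, f)| ≤ 1` for all edges `e`, `f` of distinct
degrees. -/
def LittlePullback : Prop :=
  ∀ i j : Fin k, i ≠ j → ∀ (e : G.Edge i) (f : G.Edge j),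
    (G.minExt (e : Λ) (f : Λ)).encard ≤ 1

/-- The intrinsic group `{g ∈ ℤ^k | ∏ i, m_i ^ g_i = 1}`. -/
def intrinsicGroup : AddSubgroup (Fin k → ℤ) where
  carrier := {g | ∏ i, (G.m i : ℝ) ^ (g i) = 1}
  zero_mem' := by simp
  add_mem' := by
    intro a b ha hb
    simp only [Set.mem_ofPred_eq] at ha hb ⊢
    have h : ∀ c : Fin k → ℤ, ∏ i, (G.m i : ℝ) ^ (c i) = 1 → ∀ i, (G.m i : ℝ) = 0 → c i = 0 := by
      intro c hc i hi
      by_contra h0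
      have : ∏ i, (G.m i : ℝ) ^ (c i) = 0 :=
        Finset.prod_eq_zero (Finset.mem_univ i) (by rw [hi, zero_zpow _ h0])
      rw [this] at hc
      exact zero_ne_one hc
    rw [← mul_one (1 : ℝ)]
    nth_rewrite 1 [← ha]
    rw [← hb, ← Finset.prod_mul_distrib]
    refine Finset.prod_congr rfl fun i _ => ?_
    by_cases hi : (G.m i : ℝ) = 0
    · simp [h a ha i hi, h b hb i hi]
    · rw [Pi.add_apply, zpow_add₀ hi]
  neg_mem' := by
    intro a ha
    simp only [Set.mem_ofPred_eq, Pi.neg_apply, zpow_neg, Finset.prod_inv_distrib] at ha ⊢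
    rw [ha, inv_one]

/-- A representation `S` of the semigroup `Λ` in a C*-algebra (a monoid homomorphism; since the
edges generate `Λ` subject only to the relations `e f = f' e'` between edges of two colours, this is
the same as a family of elements indexed by the edges satisfying these commutation relations) is
of Cuntz type if, for every colour `i`, the elements `S_e` with `e` of colour `i` satisfy
`S_e^* S_f = δ_{e,f}` and `∑ S_e S_e^* = 1`. -/
structure IsCuntzType {A : Type v} [Ring A] [StarRing A] (S : Λ →* A) : Prop where
  star_mul_self : ∀ (i : Fin k) (e : G.Edge i), star (S e) * S e = 1
  star_mul_of_ne : ∀ (i : Fin k) (e f : G.Edge i), e ≠ f → star (S e) * S f = 0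
  sum_mul_star : ∀ i : Fin k, ∑ e : G.Edge i, S e * star (S e) = 1

lemma eq_one_of_d_eq_zero {w : Λ} (h : G.d w = 0) : w = 1 := by
  obtain ⟨x, -, hx⟩ := G.factorization w 0 0 (by simpa using h)
  have h1 := hx (w, 1) ⟨by simp, h, G.d_one⟩
  have h2 := hx (1, w) ⟨by simp, G.d_one, h⟩
  exact congrArg Prod.fst (h1.trans h2.symm)

/-- The edges generate `Λ`. -/
lemma edge_induction {P : Λ → Prop} (h1 : P 1)
    (hmul : ∀ (i : Fin k) (e : G.Edge i) (w : Λ), P w → P ((e : Λ) * w)) (w : Λ) : P w := by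
  induction hn : ∑ i, G.d w i using Nat.strong_induction_on generalizing w with
  | _ n ih =>
    by_cases h0 : G.d w = 0
    · rw [G.eq_one_of_d_eq_zero h0]; exact h1
    · obtain ⟨i, hi⟩ := Function.ne_iff.1 h0
      have hle : Pi.single i 1 ≤ G.d w := by
        intro j
        by_cases hj : j = i
        · subst hj
          simpa [Nat.one_le_iff_ne_zero] using hi
        · simp [hj]
      obtain ⟨x, ⟨hw, hx1, hx2⟩, -⟩ := G.factorization w (Pi.single i 1) (G.d w - Pi.single i 1)
        (add_tsub_cancel_of_le hle).symm
      rw [hw]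
      refine hmul i ⟨x.1, hx1⟩ x.2 (ih _ ?_ x.2 rfl)
      rw [← hn, hw]
      refine Finset.sum_lt_sum (fun j _ => by simp [G.d_mul]) ⟨i, Finset.mem_univ i, ?_⟩
      rw [G.d_mul, Pi.add_apply, hx1]
      simp

lemma IsCuntzType.isometry {G : SingleVertexKGraph k Λ} {A : Type v} [Ring A] [StarRing A]
    {S : Λ →* A} (hS : G.IsCuntzType S) (w : Λ) : star (S w) * S w = 1 := by
  induction w using G.edge_induction with
  | h1 => simp
  | hmul i e w ih =>
    rw [map_mul, star_mul, mul_assoc, ← mul_assoc (star (S e)), hS.star_mul_self, one_mul, ih]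

/-- Cuntz-type representations of `Λ` in (nonzero, unital) C*-algebras. C*-algebras in the lowest
universe suffice: a C*-algebra generated by such a representation is separable, so it has at most
continuum many elements (see `existsUnique_lift`, where the universe is arbitrary). -/
structure Rep : Type (max u 1) where
  B : Type
  [cstar : CStarAlgebra B]
  [nontriv : Nontrivial B]
  S : Λ →* B
  isCuntz : G.IsCuntzType S

attribute [instance] Rep.cstar Rep.nontriv

/-- The C*-algebra of bounded families indexed by all Cuntz-type representations. -/
abbrev BoundedFamilies : Type (max u 1) := lp (fun R : G.Rep => R.B) ∞

noncomputable instance : CStarAlgebra G.BoundedFamilies where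

lemma Rep.norm_le {G : SingleVertexKGraph k Λ} (R : G.Rep) (w : Λ) : ‖R.S w‖ ≤ 1 := by
  have h : ‖R.S w‖ * ‖R.S w‖ = 1 := by
    rw [← CStarRing.norm_star_mul_self, R.isCuntz.isometry, CStarRing.norm_one]
  nlinarith [norm_nonneg (R.S w)]

/-- The universal Cuntz-type representation `w ↦ (S_w)_S`. -/
noncomputable def univRep : Λ →* G.BoundedFamilies where
  toFun w := ⟨fun R => R.S w, memℓp_infty ⟨1, by rintro _ ⟨R, rfl⟩; exact R.norm_le w⟩⟩
  map_one' := by ext R; simp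
  map_mul' u v := by ext R; simp

/-- The C*-algebra generated by the universal Cuntz-type representation. -/
noncomputable def algSub : StarSubalgebra ℂ G.BoundedFamilies :=
  (StarAlgebra.adjoin ℂ (Set.range G.univRep)).topologicalClosure

/-- The `k`-graph C*-algebra `O_θ`: the universal C*-algebra for Cuntz-type representations. -/
abbrev Alg : Type (max u 1) := G.algSub

instance : IsClosed (G.algSub : Set G.BoundedFamilies) :=
  StarSubalgebra.isClosed_topologicalClosure _

noncomputable instance : CStarAlgebra G.Alg := inferInstance

/-- The generators `s_w`, `w ∈ Λ`, of `O_θ`. -/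
noncomputable def s : Λ →* G.Alg where
  toFun w := ⟨G.univRep w, StarSubalgebra.le_topologicalClosure _
    (StarAlgebra.subset_adjoin ℂ _ ⟨w, rfl⟩)⟩
  map_one' := Subtype.ext (map_one G.univRep)
  map_mul' u v := Subtype.ext (map_mul G.univRep u v)

lemma s_coe_apply (w : Λ) (R : G.Rep) : ((G.s w : G.Alg) : G.BoundedFamilies) R = R.S w := rfl

lemma s_isCuntzType : G.IsCuntzType G.s where
  star_mul_self i e := by
    ext R
    exact R.isCuntz.star_mul_self i e
  star_mul_of_ne i e f h := by
    ext R
    exact R.isCuntz.star_mul_of_ne i e f h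
  sum_mul_star i := by
    ext R
    have h := R.isCuntz.sum_mul_star i
    rw [AddSubmonoidClass.coe_finsetSum, lp.coeFn_sum, Finset.sum_apply]
    exact h

/-- *-homomorphisms on `O_θ` are determined by their values on the generators. -/
lemma hom_ext {A : Type v} [CStarAlgebra A] {φ ψ : G.Alg →⋆ₐ[ℂ] A}
    (h : ∀ w, φ (G.s w) = ψ (G.s w)) : φ = ψ := by
  have hc : ∀ χ : G.Alg →⋆ₐ[ℂ] A, Continuous χ := fun χ =>
    AddMonoidHomClass.continuous_of_bound χ 1 fun x => by
      simpa using NonUnitalStarAlgHom.norm_apply_le χ x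
  refine StarAlgHom.ext_topologicalClosure (hc φ) (hc ψ) ?_
  refine StarAlgHom.ext_adjoin fun x hx => ?_
  obtain ⟨w, hw⟩ := hx
  have : (StarSubalgebra.inclusion (StarSubalgebra.le_topologicalClosure _) x : G.Alg) = G.s w :=
    Subtype.ext hw.symm
  exact (congrArg φ this).trans ((h w).trans (congrArg ψ this).symm)

lemma countable_monoid (G : SingleVertexKGraph k Λ) : Countable Λ := by
  let f : List (Σ i, G.Edge i) → Λ := fun l => (l.map fun e => (e.2 : Λ)).prod
  have hf : Function.Surjective f := by
    intro w
    induction w using G.edge_induction with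
    | h1 => exact ⟨[], by simp [f]⟩
    | hmul i e w ih =>
      obtain ⟨l, rfl⟩ := ih
      exact ⟨⟨i, e⟩ :: l, by simp [f]⟩
  exact hf.countable

/-- Evaluation of `O_θ` at a Cuntz-type representation. -/
noncomputable def evalRep (R : G.Rep) : G.Alg →⋆ₐ[ℂ] R.B where
  toFun a := (a : G.BoundedFamilies) R
  map_one' := rfl
  map_mul' _ _ := rfl
  map_zero' := rfl
  map_add' _ _ := rfl
  commutes' _ := rfl
  map_star' _ := rfl

lemma exists_cstarAlgebra_equiv (C : Type v) [CStarAlgebra C] [Small.{0} C] :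
    ∃ (B : Type) (_ : CStarAlgebra B), Nonempty (B ≃⋆ₐ[ℂ] C) := by
  let e : Shrink.{0} C ≃ₐ[ℂ] C := Shrink.algEquiv ℂ C
  let n : NormedRing (Shrink.{0} C) := NormedRing.induced _ C e e.injective
  have hn : ∀ x : Shrink.{0} C, ‖x‖ = ‖e x‖ := fun _ => rfl
  have hiso : Isometry e := AddMonoidHomClass.isometry_of_norm e fun x => (hn x).symm
  let na : NormedAlgebra ℂ (Shrink.{0} C) :=
    { norm_smul_le := fun r x => by rw [hn, hn, map_smul]; exact norm_smul_le r _ }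
  let st : StarRing (Shrink.{0} C) :=
    { star := fun x => e.symm (star (e x))
      star_involutive := fun x => by simp
      star_mul := fun x y => by
        change e.symm (star (e (x * y))) = e.symm (star (e y)) * e.symm (star (e x))
        simp
      star_add := fun x y => by
        change e.symm (star (e (x + y))) = e.symm (star (e x)) + e.symm (star (e y))
        simp }
  have hstar : ∀ x : Shrink.{0} C, e (star x) = star (e x) := fun x => e.apply_symm_apply _
  have : CompleteSpace (Shrink.{0} C) :=
    (completeSpace_congr (e := e.toEquiv) hiso.isUniformEmbedding).2 inferInstance
  have : CStarRing (Shrink.{0} C) :=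
    { norm_mul_self_le := fun x => by
        rw [hn, hn, map_mul, hstar, CStarRing.norm_star_mul_self] }
  have : StarModule ℂ (Shrink.{0} C) :=
    { star_smul := fun r x => e.injective (by rw [hstar, map_smul, map_smul, star_smul, hstar]) }
  exact ⟨Shrink.{0} C, { }, ⟨StarAlgEquiv.ofAlgEquiv e hstar⟩⟩

lemma small_closure_adjoin {A : Type v} [CStarAlgebra A] (f : ℕ → A) :
    Small.{0} (StarAlgebra.adjoin ℂ (Set.range f)).topologicalClosure := by
  let g : ℕ ⊕ ℕ → A := Sum.elim f fun n => star (f n)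
  let L : (ℕ → FreeAlgebra ℂ (ℕ ⊕ ℕ)) → A := fun x =>
    Filter.limUnder Filter.atTop fun n => FreeAlgebra.lift ℂ g (x n)
  have hr : (StarAlgebra.adjoin ℂ (Set.range f) : Set A) = Set.range (FreeAlgebra.lift ℂ g) := by
    have h1 : Set.range f ∪ star (Set.range f) = Set.range g := by
      rw [Set.Sum.elim_range]
      congr 1
      ext x
      simp [Set.mem_star, eq_star_iff_eq_star, eq_comm]
    rw [← AlgHom.coe_range, ← Algebra.adjoin_range_eq_range_freeAlgebra_lift, ← h1]
    rfl
  refine small_subset (s := Set.range L) (t :=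
    ((StarAlgebra.adjoin ℂ (Set.range f)).topologicalClosure : Set A)) ?_
  intro a ha
  rw [StarSubalgebra.topologicalClosure_coe, mem_closure_iff_seq_limit] at ha
  obtain ⟨y, hy, hlim⟩ := ha
  rw [hr] at hy
  choose x hx using hy
  refine ⟨x, ?_⟩
  have hxy : (fun n => FreeAlgebra.lift ℂ g (x n)) = y := funext hx
  rw [← hxy] at hlim
  exact hlim.limUnder_eq

/-- The universal property of `O_θ`. -/
theorem existsUnique_lift {A : Type v} [CStarAlgebra A] (S : Λ →* A) (hS : G.IsCuntzType S) :
    ∃! φ : G.Alg →⋆ₐ[ℂ] A, ∀ w, φ (G.s w) = S w := by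
  refine existsUnique_of_exists_of_unique ?_ fun φ ψ hφ hψ =>
    G.hom_ext fun w => (hφ w).trans (hψ w).symm
  rcases subsingleton_or_nontrivial A with hA | hA
  · exact ⟨{ toFun := fun _ => 0, map_one' := Subsingleton.elim _ _,
             map_mul' := fun _ _ => Subsingleton.elim _ _, map_zero' := rfl,
             map_add' := fun _ _ => Subsingleton.elim _ _,
             commutes' := fun _ => Subsingleton.elim _ _,
             map_star' := fun _ => Subsingleton.elim _ _ }, fun _ => Subsingleton.elim _ _⟩
  have := G.countable_monoid
  obtain ⟨q, hq⟩ := exists_surjective_nat Λ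
  let C : StarSubalgebra ℂ A :=
    (StarAlgebra.adjoin ℂ (Set.range fun n => S (q n))).topologicalClosure
  have : IsClosed (C : Set A) := StarSubalgebra.isClosed_topologicalClosure _
  have : Small.{0} C := small_closure_adjoin _
  obtain ⟨B, hB, ⟨e⟩⟩ := exists_cstarAlgebra_equiv C
  have hmem : ∀ w, S w ∈ C := fun w => by
    obtain ⟨n, rfl⟩ := hq w
    exact StarSubalgebra.le_topologicalClosure _ (StarAlgebra.subset_adjoin ℂ _ ⟨n, rfl⟩)
  let ι : B →⋆ₐ[ℂ] A := C.subtype.comp (e : B →⋆ₐ[ℂ] C)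
  have hι : Function.Injective ι := Subtype.val_injective.comp e.injective
  let T : Λ →* B :=
    { toFun := fun w => e.symm ⟨S w, hmem w⟩
      map_one' := hι (by simp [ι])
      map_mul' := fun u v => hι (by simp [ι]) }
  have hT : ∀ w, ι (T w) = S w := fun w => by simp [ι, T]
  have hst : ∀ x, ι (star x) = star (ι x) := map_star ι
  have : Nontrivial B := ι.toRingHom.domain_nontrivial
  have hcT : G.IsCuntzType T :=
    { star_mul_self := fun i x => hι (by simpa [hT, hst] using hS.star_mul_self i x)
      star_mul_of_ne := fun i x y h => hι (by simpa [hT, hst] using hS.star_mul_of_ne i x y h)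
      sum_mul_star := fun i => hι (by simpa [hT, hst] using hS.sum_mul_star i) }
  exact ⟨ι.comp (G.evalRep ⟨B, T, hcT⟩), fun w => hT w⟩

/-- The unimodular number `t^{d(w)} = ∏ i, t_i ^ d(w)_i`, for `t` in the torus `𝕋^k`. -/
noncomputable def character (t : Fin k → Circle) : Λ →* Circle where
  toFun w := ∏ i, t i ^ G.d w i
  map_one' := by simp [G.d_one]
  map_mul' u v := by simp [G.d_mul, pow_add, Finset.prod_mul_distrib]

lemma character_inv (t : Fin k → Circle) (w : Λ) :
    G.character t⁻¹ w * G.character t w = 1 := by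
  simp [character]

lemma character_mul (t t' : Fin k → Circle) (w : Λ) :
    G.character (t * t') w = G.character t w * G.character t' w := by
  simp [character, mul_pow, Finset.prod_mul_distrib]

/-- The representation `w ↦ t^{d(w)} S_w`. -/
noncomputable def twist (t : Fin k → Circle) {A : Type v} [Ring A] [Algebra ℂ A] (S : Λ →* A) :
    Λ →* A where
  toFun w := (G.character t w : ℂ) • S w
  map_one' := by simp
  map_mul' u v := by simp [mul_smul_mul_comm]

lemma IsCuntzType.twist {G : SingleVertexKGraph k Λ} (t : Fin k → Circle) {A : Type v}
    [CStarAlgebra A] {S : Λ →* A} (hS : G.IsCuntzType S) : G.IsCuntzType (G.twist t S) := by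
  have hc : ∀ z : Circle, star (z : ℂ) * (z : ℂ) = 1 := fun z => by
    change (starRingEnd ℂ) (z : ℂ) * (z : ℂ) = 1
    rw [← Complex.normSq_eq_conj_mul_self]
    simp
  constructor
  · intro i e
    change star ((G.character t e : ℂ) • S e) * ((G.character t e : ℂ) • S e) = 1
    rw [star_smul, smul_mul_smul_comm, hc, hS.star_mul_self, one_smul]
  · intro i e f h
    change star ((G.character t e : ℂ) • S e) * ((G.character t f : ℂ) • S f) = 0
    rw [star_smul, smul_mul_smul_comm, hS.star_mul_of_ne i e f h, smul_zero]
  · intro i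
    rw [← hS.sum_mul_star i]
    refine Finset.sum_congr rfl fun e _ => ?_
    change ((G.character t e : ℂ) • S e) * star ((G.character t e : ℂ) • S e) = _
    rw [star_smul, smul_mul_smul_comm, mul_comm, hc, one_smul]

/-- The gauge endomorphism `s_w ↦ t^{d(w)} s_w`. -/
noncomputable def gaugeHom (t : Fin k → Circle) : G.Alg →⋆ₐ[ℂ] G.Alg :=
  (G.existsUnique_lift (G.twist t G.s) (G.s_isCuntzType.twist t)).choose

lemma gaugeHom_s (t : Fin k → Circle) (w : Λ) :
    G.gaugeHom t (G.s w) = (G.character t w : ℂ) • G.s w :=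
  (G.existsUnique_lift (G.twist t G.s) (G.s_isCuntzType.twist t)).choose_spec.1 w

lemma gaugeHom_comp (t t' : Fin k → Circle) :
    (G.gaugeHom t).comp (G.gaugeHom t') = G.gaugeHom (t * t') := by
  refine G.hom_ext fun w => ?_
  rw [StarAlgHom.comp_apply, gaugeHom_s, map_smul, gaugeHom_s, gaugeHom_s, smul_smul,
    character_mul, Circle.coe_mul, mul_comm]

lemma gaugeHom_one : G.gaugeHom 1 = StarAlgHom.id ℂ G.Alg := by
  refine G.hom_ext fun w => ?_
  simp [gaugeHom_s, character]

/-- The gauge automorphism `γ_t`, `t ∈ 𝕋^k`, of `O_θ`, given by `γ_t(s_w) = t^{d(w)} s_w`. -/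
noncomputable def gauge (t : Fin k → Circle) : G.Alg ≃⋆ₐ[ℂ] G.Alg :=
  StarAlgEquiv.ofStarAlgHom (G.gaugeHom t) (G.gaugeHom t⁻¹)
    (by rw [gaugeHom_comp, inv_mul_cancel, gaugeHom_one])
    (by rw [gaugeHom_comp, mul_inv_cancel, gaugeHom_one])

lemma gauge_s (t : Fin k → Circle) (w : Λ) :
    G.gauge t (G.s w) = (G.character t w : ℂ) • G.s w := G.gaugeHom_s t w

lemma gauge_gauge (t t' : Fin k → Circle) (a : G.Alg) :
    G.gauge t (G.gauge t' a) = G.gauge (t * t') a :=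
  DFunLike.congr_fun (G.gaugeHom_comp t t') a

/-- The fixed point algebra of a family of automorphisms. -/
def fixedPoints {ι : Type*} {A : Type v} [CStarAlgebra A] (α : ι → (A ≃⋆ₐ[ℂ] A)) :
    StarSubalgebra ℂ A where
  carrier := {a | ∀ t, α t a = a}
  mul_mem' ha hb t := by rw [map_mul, ha t, hb t]
  one_mem' t := map_one _
  add_mem' ha hb t := by rw [map_add, ha t, hb t]
  zero_mem' t := map_zero _
  algebraMap_mem' r t := by
    rw [Algebra.algebraMap_eq_smul_one, map_smul, map_one]
  star_mem' ha t := by rw [map_star, ha t]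

/-- The core `𝔉`: the fixed point algebra of the gauge action. -/
noncomputable def core : StarSubalgebra ℂ G.Alg := fixedPoints G.gauge

/-- `Φ₀(a) = ∫_{𝕋^k} γ_t(a) dt`, with respect to normalized Haar measure; `𝕋^k` is parametrized
by `(ℝ/ℤ)^k`. -/
noncomputable def expectation (a : G.Alg) : G.Alg :=
  ∫ x : UnitAddTorus (Fin k), G.gauge (fun i => (x i).toCircle) a
    ∂(MeasureTheory.Measure.pi fun _ => AddCircle.haarAddCircle)

lemma expectation_mem_core (a : G.Alg) : G.expectation a ∈ G.core := by
  intro t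
  have h : ∀ i, ∃ y : UnitAddCircle, y.toCircle = t i := fun i => by
    obtain ⟨y, hy⟩ := (AddCircle.homeomorphCircle one_ne_zero).surjective (t i)
    exact ⟨y, by rw [← hy, AddCircle.homeomorphCircle_apply]⟩
  choose y hy using h
  have hiso : Isometry (G.gauge t) := NonUnitalStarAlgHom.isometry _ (G.gauge t).injective
  let L : G.Alg ≃ₗᵢ[ℂ] G.Alg :=
    { toFun := G.gauge t
      invFun := (G.gauge t).symm
      left_inv := (G.gauge t).left_inv
      right_inv := (G.gauge t).right_inv
      map_add' := map_add _
      map_smul' := map_smul _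
      norm_map' := fun x => hiso.norm_map_of_map_zero (map_zero _) x }
  have hL : ∀ b, L b = G.gauge t b := fun _ => rfl
  rw [← hL, expectation]
  have h1 := L.toContinuousLinearEquiv.integral_comp_comm
    (μ := MeasureTheory.Measure.pi fun _ : Fin k => AddCircle.haarAddCircle (T := 1))
    (fun x : UnitAddTorus (Fin k) => G.gauge (fun i => (x i).toCircle) a)
  refine Eq.trans h1.symm ?_
  have h2 : ∀ x : UnitAddTorus (Fin k),
      L.toContinuousLinearEquiv (G.gauge (fun i => (x i).toCircle) a) =
        (fun z : UnitAddTorus (Fin k) => G.gauge (fun i => (z i).toCircle) a) (y + x) := by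
    intro x
    refine (G.gauge_gauge t _ a).trans ?_
    have : (t * fun i => (x i).toCircle) = fun i => ((y + x) i).toCircle := by
      funext i
      rw [Pi.mul_apply, Pi.add_apply, AddCircle.toCircle_add, hy]
    rw [this]
  simp_rw [h2]
  exact MeasureTheory.integral_add_left_eq_self
    (μ := MeasureTheory.Measure.pi fun _ : Fin k => AddCircle.haarAddCircle (T := 1))
    (fun z : UnitAddTorus (Fin k) => G.gauge (fun i => (z i).toCircle) a) y

/-- A tracial state: a positive unital linear functional with `φ(ab) = φ(ba)`. -/
structure IsTracialState {A : Type v} [Ring A] [StarRing A] [Algebra ℂ A] (φ : A →ₗ[ℂ] ℂ) :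
    Prop where
  map_one : φ 1 = 1
  re_nonneg : ∀ a, 0 ≤ (φ (star a * a)).re
  im_eq_zero : ∀ a, (φ (star a * a)).im = 0
  tracial : ∀ a b, φ (a * b) = φ (b * a)

/-- The functional `ω = τ ∘ Φ₀` on `O_θ`. -/
noncomputable def omega (τ : G.core →ₗ[ℂ] ℂ) (a : G.Alg) : ℂ :=
  τ ⟨G.expectation a, G.expectation_mem_core a⟩

/-- The flow `σ` on `O_θ` with
`σ_t(s_u s_v^*) = m^{it(d(v) - d(u))} s_u s_v^*`, i.e. `σ_t = γ_{(m_1^{-it}, …, m_k^{-it})}`. -/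
noncomputable def modularFlow (t : ℝ) : G.Alg ≃⋆ₐ[ℂ] G.Alg :=
  G.gauge fun i => Circle.exp (-(t * Real.log (G.m i)))

/-- `σ` is the modular automorphism group of the functional `ω`: a strongly continuous
one-parameter group of automorphisms that preserves `ω` and satisfies the modular (KMS) condition:
for all `a`, `b` there is a bounded continuous function `F` on the strip `0 ≤ Im z ≤ 1`, analytic
in its interior, with `F(t) = ω(σ_t(a) b)` and `F(t + i) = ω(b σ_t(a))` for all real `t`. -/
structure IsModularGroup {A : Type v} [CStarAlgebra A] (ω : A → ℂ) (σ : ℝ → (A ≃⋆ₐ[ℂ] A)) :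
    Prop where
  map_zero : ∀ a, σ 0 a = a
  map_add : ∀ t u a, σ (t + u) a = σ t (σ u a)
  continuous : ∀ a, Continuous fun t => σ t a
  invariant : ∀ t a, ω (σ t a) = ω a
  kms : ∀ a b, ∃ F : ℂ → ℂ, DiffContOnCl ℂ F {z | 0 < z.im ∧ z.im < 1} ∧
    (∃ C : ℝ, ∀ z : ℂ, 0 ≤ z.im → z.im ≤ 1 → ‖F z‖ ≤ C) ∧
    ∀ t : ℝ, F t = ω (σ t a * b) ∧ F (t + Complex.I) = ω (b * σ t a)

/-- The fixed point algebra `O_θ^σ` of the modular action. -/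
noncomputable def modularFixed : StarSubalgebra ℂ G.Alg := fixedPoints G.modularFlow

lemma core_le_modularFixed : G.core ≤ G.modularFixed := fun _ ha _ => ha _

end SingleVertexKGraph

/-! Averaging a state `ψ` as `m⁻ᵖ ∑ ψ(s_w^* · s_w)` over the words `w` of degree `p`, and
letting `p` grow, produces a state `φ` with `φ(x b) = φ(b x)` for every `x = s_u s_v^*` with
`d(u) = d(v)`; here `O_θ ≠ 0`, since `Λ` acts on `ℓ²` of the direct limit of `Λ` along right
multiplication by a word that contains every colour. The gauge average `ω` of `φ` takes the value
`m^{-d(u)} δ_{u,v}` on `s_u s_v^*`; this determines `ω`, makes it a KMS functional for `σ`, and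
makes its restrictions to the core and to the fixed point algebra tracial.

For uniqueness, `O_θ^σ` is the closed span of the `s_u s_v^*` with `m^{d(u)} = m^{d(v)}`, so it
suffices that a tracial state `φ` vanishes on those with `d(u) ≠ d(v)`. Under (b) there are none.
Under (a), cancelling common prefixes reduces to `d(u) ∧ d(v) = 0`; then the little pull-back
property leaves at most one word `w` of degree `n d(u)` with `s_w^* s_u s_v^* s_w ≠ 0`, whence
`|φ(s_u s_v^*)| ≤ m^{-n d(u)}` for every `n`, and `m^{d(u)} > 1`. -/

lemma add_eq_sup_of_disjoint {ι : Type*} {p q : ι → ℕ} (h : Disjoint p q) : p + q = p ⊔ q := by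
  funext i
  have hi : p i = 0 ∨ q i = 0 := by simpa using (Pi.disjoint_iff.1 h i).eq_bot
  rcases hi with hi | hi <;> simp [hi]

lemma degree_induction {ι : Type*} [Finite ι] [DecidableEq ι] {P : (ι → ℕ) → Prop} (zero : P 0)
    (single_add : ∀ i p, P p → P (Pi.single i 1 + p)) (p : ι → ℕ) : P p := by
  suffices h : ∀ q, P q → P (p + q) by simpa using h 0 zero
  induction p using Pi.single_induction with
  | zero => simp
  | add p q hp hq => exact fun r hr => by simpa only [add_assoc] using hp _ (hq r hr)
  | single i n =>
    induction n with
    | zero => simp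
    | succ n ih =>
      intro q hq
      rw [add_comm n, Pi.single_add, add_assoc]
      exact single_add i _ (ih q hq)

section FixedVectors

variable {𝕜 E F ι T : Type*} [RCLike 𝕜] [NormedAddCommGroup E] [NormedSpace 𝕜 E] [FunLike F E E]
  [LinearMapClass F 𝕜 E E] {α : T → F} {x : ι → E} {P : Set ι}

/-- Averaging `α t` with the identity kills the vectors which `α t` negates and does not move the
fixed ones, so the vectors outside `P` can be removed from an approximation of `a` one by one. -/
lemma exists_mem_span_image_norm_sub_le (hα : ∀ t y, ‖α t y‖ ≤ ‖y‖)
    (heig : ∀ t i, ∃ c : 𝕜, α t (x i) = c • x i) (hfix : ∀ i ∈ P, ∀ t, α t (x i) = x i)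
    (hneg : ∀ i ∉ P, ∃ t, α t (x i) = -x i) {a : E} (ha : ∀ t, α t a = a) (s : Finset ι)
    (c : ι → 𝕜) {z : E} (hz : z ∈ Submodule.span 𝕜 (x '' P)) :
    ∃ z' ∈ Submodule.span 𝕜 (x '' P), ‖a - z'‖ ≤ ‖a - (z + ∑ i ∈ s, c i • x i)‖ := by
  classical
  induction s using Finset.induction_on generalizing c z with
  | empty => exact ⟨z, hz, by simp⟩
  | insert i s his ih =>
    rw [Finset.sum_insert his]
    by_cases hi : i ∈ P
    · rw [← add_assoc]
      exact ih c (add_mem hz (Submodule.smul_mem _ _ (Submodule.subset_span ⟨i, hi, rfl⟩)))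
    · obtain ⟨t, ht⟩ := hneg i hi
      choose e he using heig t
      let R : E →ₗ[𝕜] E := (2⁻¹ : 𝕜) • (LinearMap.id + (α t : E →ₗ[𝕜] E))
      have R_apply : ∀ y, R y = (2⁻¹ : 𝕜) • (y + α t y) := fun _ => rfl
      have R_of_fixed : ∀ y, α t y = y → R y = y := fun y hy => by
        rw [R_apply, hy, ← two_smul 𝕜 y, inv_smul_smul₀ two_ne_zero]
      have norm_R_le : ∀ y, ‖R y‖ ≤ ‖y‖ := fun y => by
        rw [R_apply, norm_smul, norm_inv, RCLike.norm_two]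
        linarith [norm_add_le y (α t y), hα t y]
      have hRz : α t z = z := by
        have hle : Submodule.span 𝕜 (x '' P) ≤ LinearMap.eqLocus (α t) LinearMap.id :=
          Submodule.span_le.2 <| by
            rintro _ ⟨j, hj, rfl⟩
            exact hfix j hj t
        exact hle hz
      obtain ⟨z', hz', hle⟩ := ih (fun j => c j * (2⁻¹ * (1 + e j))) hz
      refine ⟨z', hz', hle.trans (le_trans (le_of_eq ?_) (norm_R_le _))⟩
      have hRi : R (x i) = 0 := by rw [R_apply, ht, add_neg_cancel, smul_zero]
      have hRj : ∀ j, R (x j) = (2⁻¹ * (1 + e j)) • x j := fun j => by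
        rw [R_apply, he, mul_smul, add_smul, one_smul]
      simp only [map_sub, map_add, map_sum, map_smul, R_of_fixed a (ha t), R_of_fixed z hRz, hRi,
        hRj, smul_zero, zero_add, mul_smul]

lemma mem_closure_span_image_of_fixed (hx : Dense (Submodule.span 𝕜 (Set.range x) : Set E))
    (hα : ∀ t y, ‖α t y‖ ≤ ‖y‖) (heig : ∀ t i, ∃ c : 𝕜, α t (x i) = c • x i)
    (hfix : ∀ i ∈ P, ∀ t, α t (x i) = x i) (hneg : ∀ i ∉ P, ∃ t, α t (x i) = -x i) {a : E}
    (ha : ∀ t, α t a = a) : a ∈ closure (Submodule.span 𝕜 (x '' P) : Set E) := by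
  refine Metric.mem_closure_iff.2 fun ε hε => ?_
  obtain ⟨y, hy, hay⟩ := Metric.mem_closure_iff.1 (hx a) ε hε
  obtain ⟨c, rfl⟩ := Finsupp.mem_span_range_iff_exists_finsupp.1 hy
  obtain ⟨z, hz, hle⟩ := exists_mem_span_image_norm_sub_le hα heig hfix hneg ha c.support c
    (zero_mem _)
  rw [zero_add] at hle
  rw [dist_eq_norm] at hay
  exact ⟨z, hz, by rw [dist_eq_norm]; exact hle.trans_lt hay⟩

end FixedVectors

lemma norm_starAlgEquiv_apply {A B : Type*} [CStarAlgebra A] [CStarAlgebra B] (α : A ≃⋆ₐ[ℂ] B)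
    (a : A) : ‖α a‖ = ‖a‖ :=
  NonUnitalStarAlgHom.norm_map α α.injective a

lemma continuous_starAlgEquiv {A B : Type*} [CStarAlgebra A] [CStarAlgebra B] (α : A ≃⋆ₐ[ℂ] B) :
    Continuous α :=
  (NonUnitalStarAlgHom.isometry α α.injective).continuous

section HilbertBasis

variable {ι 𝕜 E E' : Type*} [RCLike 𝕜] [NormedAddCommGroup E] [InnerProductSpace 𝕜 E]
  [NormedAddCommGroup E'] [InnerProductSpace 𝕜 E'] [CompleteSpace E']

open Classical in
lemma exists_linearIsometry_apply_hilbertBasis (b : HilbertBasis ι 𝕜 E) {v : ι → E'}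
    (hv : Orthonormal 𝕜 v) : ∃ V : E →ₗᵢ[𝕜] E', ∀ i, V (b i) = v i :=
  ⟨hv.orthogonalFamily.linearIsometry.comp b.repr.toLinearIsometry, fun i => by
    simp [b.repr_self]⟩

lemma clm_ext_hilbertBasis {F : Type*} [NormedAddCommGroup F] [NormedSpace 𝕜 F]
    (b : HilbertBasis ι 𝕜 E) {S T : E →L[𝕜] F} (h : ∀ i, S (b i) = T (b i)) : S = T :=
  ContinuousLinearMap.ext_on (Submodule.dense_iff_topologicalClosure_eq_top.2 b.dense_span) <| by
    rintro _ ⟨i, rfl⟩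
    exact h i

lemma ext_inner_hilbertBasis (b : HilbertBasis ι 𝕜 E) {x y : E}
    (h : ∀ i, inner 𝕜 (b i) x = inner 𝕜 (b i) y) : x = y :=
  b.repr.injective <| lp.ext <| funext fun i => by
    rw [b.repr_apply_apply, b.repr_apply_apply, h]

end HilbertBasis

section ClosureSpan

lemma apply_mul_comm_of_mem_closure_span {𝕜 A : Type*} [NontriviallyNormedField 𝕜]
    [NormedRing A] [NormedAlgebra 𝕜 A] (ω : A →L[𝕜] 𝕜) {s : Set A} {b : A}
    (h : ∀ x ∈ s, ω (x * b) = ω (b * x)) {a : A} (ha : a ∈ closure (Submodule.span 𝕜 s : Set A)) :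
    ω (a * b) = ω (b * a) :=
  ContinuousLinearMap.eqOn_closure_span (f := ω ∘L (ContinuousLinearMap.mul 𝕜 A).flip b)
    (g := ω ∘L ContinuousLinearMap.mul 𝕜 A b) h ha

lemma dense_span_preimage_coe {R A : Type*} [CommSemiring R] [StarRing R] [TopologicalSpace A]
    [Semiring A] [StarRing A] [Algebra R A] [StarModule R A] {B : StarSubalgebra R A} {s : Set A}
    (hsB : s ⊆ B) (hBs : (B : Set A) ⊆ closure (Submodule.span R s : Set A)) :
    Dense (Submodule.span R ((↑) ⁻¹' s : Set B) : Set B) := fun a => by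
  have image_eq : ((↑) '' (Submodule.span R ((↑) ⁻¹' s : Set B) : Set B) : Set A) =
      Submodule.span R s := by
    have := Submodule.map_span (B.subtype : B →ₗ[R] A) ((↑) ⁻¹' s)
    rw [show (⇑(B.subtype : B →ₗ[R] A) '' ((↑) ⁻¹' s)) = s from
      Set.image_preimage_eq_of_subset (by simpa using hsB)] at this
    exact congrArg SetLike.coe this
  rw [closure_subtype, image_eq]
  exact hBs a.2

end ClosureSpan

section Strip

open Filter Topology

/-- A bounded continuous function on the strip `0 ≤ Im z ≤ 1` that is analytic in its interior. -/
structure IsStripFunction (F : ℂ → ℂ) : Prop where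
  diffContOnCl : DiffContOnCl ℂ F {z | 0 < z.im ∧ z.im < 1}
  bounded : ∃ C : ℝ, ∀ z : ℂ, 0 ≤ z.im → z.im ≤ 1 → ‖F z‖ ≤ C

namespace IsStripFunction

variable {F F' : ℂ → ℂ}

lemma add (hF : IsStripFunction F) (hF' : IsStripFunction F') : IsStripFunction (F + F') where
  diffContOnCl := hF.diffContOnCl.add hF'.diffContOnCl
  bounded := by
    obtain ⟨C, hC⟩ := hF.bounded
    obtain ⟨C', hC'⟩ := hF'.bounded
    exact ⟨C + C', fun z h0 h1 => norm_add_le_of_le (hC z h0 h1) (hC' z h0 h1)⟩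

lemma const_smul (hF : IsStripFunction F) (c : ℂ) : IsStripFunction (c • F) where
  diffContOnCl := hF.diffContOnCl.const_smul c
  bounded := by
    obtain ⟨C, hC⟩ := hF.bounded
    refine ⟨‖c‖ * C, fun z h0 h1 => ?_⟩
    exact (norm_smul_le c (F z)).trans (by gcongr; exact hC z h0 h1)

lemma norm_le (hF : IsStripFunction F) {D : ℝ} (hD : ∀ z : ℂ, z.im = 0 ∨ z.im = 1 → ‖F z‖ ≤ D)
    {z : ℂ} (h0 : 0 ≤ z.im) (h1 : z.im ≤ 1) : ‖F z‖ ≤ D := by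
  obtain ⟨C, hC⟩ := hF.bounded
  refine PhragmenLindelof.horizontal_strip (a := 0) (b := 1) hF.diffContOnCl
    ⟨0, by simpa using Real.pi_pos, 0, Asymptotics.IsBigO.of_bound C ?_⟩
    (fun w hw => hD w (.inl hw)) (fun w hw => hD w (.inr hw)) h0 h1
  rw [eventually_inf_principal]
  exact Eventually.of_forall fun w hw => by simpa using hC w hw.1.le hw.2.le

lemma uniformCauchySeqOn {F : ℕ → ℂ → ℂ} (hF : ∀ n, IsStripFunction (F n))
    (hc : UniformCauchySeqOn F atTop {z | z.im = 0 ∨ z.im = 1}) :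
    UniformCauchySeqOn F atTop {z | 0 ≤ z.im ∧ z.im ≤ 1} := by
  refine Metric.uniformCauchySeqOn_iff.2 fun ε hε => ?_
  obtain ⟨N, hN⟩ := Metric.uniformCauchySeqOn_iff.1 hc (ε / 2) (half_pos hε)
  refine ⟨N, fun m hm n hn z hz => lt_of_le_of_lt ?_ (half_lt_self hε)⟩
  have norm_sub_le : ‖(F m + (-1 : ℂ) • F n) z‖ ≤ ε / 2 :=
    ((hF m).add ((hF n).const_smul (-1))).norm_le
      (fun w hw => by simpa [dist_eq_norm, sub_eq_add_neg] using (hN m hm n hn w hw).le) hz.1 hz.2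
  simpa [dist_eq_norm, sub_eq_add_neg] using norm_sub_le

lemma of_tendstoUniformlyOn {F : ℕ → ℂ → ℂ} (hF : ∀ n, IsStripFunction (F n)) {f : ℂ → ℂ}
    (hf : TendstoUniformlyOn F f atTop {z | 0 ≤ z.im ∧ z.im ≤ 1}) : IsStripFunction f where
  diffContOnCl := by
    have isOpen_strip : IsOpen {z : ℂ | 0 < z.im ∧ z.im < 1} :=
      isOpen_Ioo.preimage Complex.continuous_im
    have closure_strip : closure {z : ℂ | 0 < z.im ∧ z.im < 1} = {z | 0 ≤ z.im ∧ z.im ≤ 1} :=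
      (Complex.closure_preimage_im (Set.Ioo 0 1)).trans (by rw [closure_Ioo zero_ne_one]; rfl)
    refine ⟨(hf.mono fun z hz => ⟨hz.1.le, hz.2.le⟩).tendstoLocallyUniformlyOn.differentiableOn
      (Eventually.of_forall fun n => (hF n).diffContOnCl.differentiableOn) isOpen_strip, ?_⟩
    rw [closure_strip]
    exact hf.continuousOn (Frequently.of_forall fun n =>
      closure_strip ▸ (hF n).diffContOnCl.continuousOn)
  bounded := by
    obtain ⟨n, hn⟩ := (Metric.tendstoUniformlyOn_iff.1 hf 1 one_pos).exists
    obtain ⟨C, hC⟩ := (hF n).bounded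
    refine ⟨1 + C, fun z h0 h1 => ?_⟩
    have hdist := hn z ⟨h0, h1⟩
    rw [dist_eq_norm] at hdist
    calc ‖f z‖ = ‖(f z - F n z) + F n z‖ := by rw [sub_add_cancel]
      _ ≤ 1 + C := norm_add_le_of_le hdist.le (hC z h0 h1)

lemma exists_tendsto {F : ℕ → ℂ → ℂ} (hF : ∀ n, IsStripFunction (F n))
    (hc : UniformCauchySeqOn F atTop {z | z.im = 0 ∨ z.im = 1}) :
    ∃ f, IsStripFunction f ∧
      ∀ z : ℂ, 0 ≤ z.im → z.im ≤ 1 → Tendsto (fun n => F n z) atTop (𝓝 (f z)) := by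
  have hu := uniformCauchySeqOn hF hc
  have exists_limit : ∀ z : ℂ, ∃ y, z ∈ {z : ℂ | 0 ≤ z.im ∧ z.im ≤ 1} →
      Tendsto (fun n => F n z) atTop (𝓝 y) := fun z => by
    by_cases hz : z ∈ {z : ℂ | 0 ≤ z.im ∧ z.im ≤ 1}
    · exact (cauchySeq_tendsto_of_complete (hu.cauchySeq hz)).imp fun _ hy _ => hy
    · exact ⟨0, fun h => absurd h hz⟩
  choose f hf using exists_limit
  exact ⟨f, of_tendstoUniformlyOn hF (hu.tendstoUniformlyOn_of_tendsto hf),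
    fun z h0 h1 => hf z ⟨h0, h1⟩⟩

end IsStripFunction

end Strip

section KMSFunction

open Filter Topology

variable {A : Type*} [CStarAlgebra A] {ω : A →L[ℂ] ℂ} {σ : ℝ → A ≃⋆ₐ[ℂ] A}

/-- The function `F` witnesses the KMS condition of `ω` and `σ` for the pair `a`, `b`. -/
structure IsKMSFunction (ω : A →L[ℂ] ℂ) (σ : ℝ → A ≃⋆ₐ[ℂ] A) (a b : A) (F : ℂ → ℂ) : Prop
    extends IsStripFunction F where
  apply_ofReal : ∀ t : ℝ, F t = ω (σ t a * b)
  apply_ofReal_add_I : ∀ t : ℝ, F (t + Complex.I) = ω (b * σ t a)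

namespace IsKMSFunction

variable {a a' b : A} {F F' : ℂ → ℂ}

lemma add (hF : IsKMSFunction ω σ a b F) (hF' : IsKMSFunction ω σ a' b F') :
    IsKMSFunction ω σ (a + a') b (F + F') where
  toIsStripFunction := hF.toIsStripFunction.add hF'.toIsStripFunction
  apply_ofReal t := by
    simp only [Pi.add_apply, hF.apply_ofReal, hF'.apply_ofReal, map_add, add_mul]
  apply_ofReal_add_I t := by
    simp only [Pi.add_apply, hF.apply_ofReal_add_I, hF'.apply_ofReal_add_I, map_add, mul_add]

lemma const_smul (hF : IsKMSFunction ω σ a b F) (c : ℂ) :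
    IsKMSFunction ω σ (c • a) b (c • F) where
  toIsStripFunction := hF.toIsStripFunction.const_smul c
  apply_ofReal t := by
    simp only [Pi.smul_apply, hF.apply_ofReal, map_smul, smul_mul_assoc]
  apply_ofReal_add_I t := by
    simp only [Pi.smul_apply, hF.apply_ofReal_add_I, map_smul, mul_smul_comm]

lemma norm_le_of_im (hF : IsKMSFunction ω σ a b F) {z : ℂ} (hz : z.im = 0 ∨ z.im = 1) :
    ‖F z‖ ≤ ‖ω‖ * (‖a‖ * ‖b‖) := by
  obtain hz | hz := hz
  · rw [show z = (z.re : ℂ) from Complex.ext rfl (by simpa using hz), hF.apply_ofReal]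
    refine ω.le_opNorm_of_le ((norm_mul_le _ _).trans_eq ?_)
    rw [norm_starAlgEquiv_apply]
  · rw [show z = z.re + Complex.I from Complex.ext (by simp) (by simpa using hz),
      hF.apply_ofReal_add_I]
    refine ω.le_opNorm_of_le ((norm_mul_le _ _).trans_eq ?_)
    rw [norm_starAlgEquiv_apply, mul_comm]

lemma uniformCauchySeqOn {x : ℕ → A} {F : ℕ → ℂ → ℂ} (hF : ∀ n, IsKMSFunction ω σ (x n) b (F n))
    (hx : CauchySeq x) : UniformCauchySeqOn F atTop {z | z.im = 0 ∨ z.im = 1} := by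
  refine Metric.uniformCauchySeqOn_iff.2 fun ε hε => ?_
  set D := ‖ω‖ * ‖b‖ + 1
  have hD : 0 < D := by positivity
  obtain ⟨N, hN⟩ := Metric.cauchySeq_iff.1 hx (ε / D) (by positivity)
  refine ⟨N, fun m hm n hn z hz => ?_⟩
  have norm_sub_le := ((hF m).add ((hF n).const_smul (-1))).norm_le_of_im hz
  have hdist := hN m hm n hn
  simp only [Pi.add_apply, Pi.neg_apply, neg_smul, one_smul, ← sub_eq_add_neg,
    ← dist_eq_norm] at norm_sub_le
  calc dist (F m z) (F n z) ≤ ‖ω‖ * (dist (x m) (x n) * ‖b‖) := norm_sub_le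
    _ ≤ D * dist (x m) (x n) := by nlinarith [dist_nonneg (x := x m) (y := x n)]
    _ < D * (ε / D) := mul_lt_mul_of_pos_left hdist hD
    _ = ε := mul_div_cancel₀ _ hD.ne'

lemma exists_of_tendsto {x : ℕ → A} {F : ℕ → ℂ → ℂ} (hF : ∀ n, IsKMSFunction ω σ (x n) b (F n))
    (hx : Tendsto x atTop (𝓝 a)) : ∃ f, IsKMSFunction ω σ a b f := by
  obtain ⟨f, hf, hlim⟩ := IsStripFunction.exists_tendsto (fun n => (hF n).toIsStripFunction)
    (uniformCauchySeqOn hF hx.cauchySeq)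
  have tendsto_flow : ∀ t, Tendsto (fun n => σ t (x n)) atTop (𝓝 (σ t a)) := fun t =>
    ((continuous_starAlgEquiv (σ t)).tendsto a).comp hx
  refine ⟨f, hf, fun t => tendsto_nhds_unique (hlim t (by simp) (by simp)) ?_,
    fun t => tendsto_nhds_unique (hlim (t + Complex.I) (by simp) (by simp)) ?_⟩
  · simp only [fun n => (hF n).apply_ofReal t]
    exact (ω.continuous.tendsto _).comp ((tendsto_flow t).mul_const b)
  · simp only [fun n => (hF n).apply_ofReal_add_I t]
    exact (ω.continuous.tendsto _).comp ((tendsto_flow t).const_mul b)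

lemma exists_of_mem_closure_span {s : Set A} (hs : s.Nonempty)
    (h : ∀ x ∈ s, ∃ F, IsKMSFunction ω σ x b F)
    (ha : a ∈ closure (Submodule.span ℂ s : Set A)) : ∃ F, IsKMSFunction ω σ a b F := by
  let V : Submodule ℂ A :=
    { carrier := {x | ∃ F, IsKMSFunction ω σ x b F}
      zero_mem' := by
        obtain ⟨x, hx⟩ := hs
        obtain ⟨F, hF⟩ := h x hx
        exact ⟨(0 : ℂ) • F, by simpa only [zero_smul] using hF.const_smul 0⟩
      add_mem' := fun ⟨F, hF⟩ ⟨F', hF'⟩ => ⟨F + F', hF.add hF'⟩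
      smul_mem' := fun c _ ⟨F, hF⟩ => ⟨c • F, hF.const_smul c⟩ }
  obtain ⟨x, hx, hlim⟩ := mem_closure_iff_seq_limit.1 ha
  choose F hF using fun n => (Submodule.span_le (p := V)).2 h (hx n)
  exact exists_of_tendsto hF hlim

end IsKMSFunction

end KMSFunction

namespace SingleVertexKGraph

variable {k : ℕ} {Λ : Type u} [Monoid Λ] (G : SingleVertexKGraph k Λ)

section Factorization

lemma eq_and_eq_of_mul_eq_mul {a b a' b' : Λ} (h : a * b = a' * b') (hd : G.d a = G.d a') :
    a = a' ∧ b = b' := by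
  have hb : G.d b = G.d b' := by
    have hab := congrArg G.d h
    rw [G.d_mul, G.d_mul, hd] at hab
    exact add_left_cancel hab
  have := (G.factorization (a * b) _ _ (G.d_mul a b)).unique (y₁ := (a, b)) (y₂ := (a', b'))
    ⟨rfl, rfl, rfl⟩ ⟨h, hd.symm, hb.symm⟩
  exact Prod.mk.inj this

lemma eq_of_mul_eq_mul_left (G : SingleVertexKGraph k Λ) {a b b' : Λ}
    (h : a * b = a * b') : b = b' :=
  (G.eq_and_eq_of_mul_eq_mul h rfl).2

lemma eq_of_mul_eq_mul_right (G : SingleVertexKGraph k Λ) {a a' b : Λ}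
    (h : a * b = a' * b) : a = a' := by
  refine (G.eq_and_eq_of_mul_eq_mul h ?_).1
  have hd := congrArg G.d h
  rw [G.d_mul, G.d_mul] at hd
  exact add_right_cancel hd

lemma exists_eq_mul_of_d_eq_add {w : Λ} {p q : Fin k → ℕ} (h : G.d w = p + q) :
    ∃ a b, w = a * b ∧ G.d a = p ∧ G.d b = q := by
  obtain ⟨x, hx, -⟩ := G.factorization w p q h
  exact ⟨x.1, x.2, hx⟩

lemma exists_eq_mul_of_le_d {w : Λ} {p : Fin k → ℕ} (h : p ≤ G.d w) :
    ∃ a b, w = a * b ∧ G.d a = p := by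
  obtain ⟨a, b, hw, ha, -⟩ := G.exists_eq_mul_of_d_eq_add (add_tsub_cancel_of_le h).symm
  exact ⟨a, b, hw, ha⟩

end Factorization

section Words

/-- The words of degree `p`; those of degree `ε_i` are the edges of colour `i`. -/
abbrev Word (p : Fin k → ℕ) : Type u := {w : Λ // G.d w = p}

/-- Unique factorization: a word of degree `p + q` is a word of degree `p` followed by one of degree
`q`. -/
noncomputable def wordMul (p q : Fin k → ℕ) : G.Word p × G.Word q ≃ G.Word (p + q) :=
  Equiv.ofBijective (fun x => ⟨x.1 * x.2, by rw [G.d_mul, x.1.2, x.2.2]⟩) <| by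
    constructor
    · rintro ⟨⟨a, ha⟩, ⟨b, hb⟩⟩ ⟨⟨a', ha'⟩, ⟨b', hb'⟩⟩ h
      obtain ⟨rfl, rfl⟩ := G.eq_and_eq_of_mul_eq_mul (Subtype.ext_iff.1 h) (ha.trans ha'.symm)
      rfl
    · rintro ⟨w, hw⟩
      obtain ⟨a, b, rfl, ha, hb⟩ := G.exists_eq_mul_of_d_eq_add hw
      exact ⟨(⟨a, ha⟩, ⟨b, hb⟩), rfl⟩

@[simp] lemma wordMul_coe (p q : Fin k → ℕ) (x : G.Word p × G.Word q) :
    (G.wordMul p q x : Λ) = x.1 * x.2 := rfl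

instance uniqueWordZero : Unique (G.Word 0) where
  default := ⟨1, G.d_one⟩
  uniq w := Subtype.ext (G.eq_one_of_d_eq_zero w.2)

instance finite_word (p : Fin k → ℕ) : Finite (G.Word p) := by
  induction p using degree_induction with
  | zero => infer_instance
  | single_add i p ih =>
    have := G.finite_edges i
    exact Finite.of_equiv _ (G.wordMul (Pi.single i 1) p)

noncomputable instance fintypeWord (p : Fin k → ℕ) : Fintype (G.Word p) := Fintype.ofFinite _

/-- The number `m^p = ∏ i, m_i ^ p_i` of words of degree `p`, as a real number. -/
noncomputable def weight (p : Fin k → ℕ) : ℝ := ∏ i, (G.m i : ℝ) ^ p i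

@[simp] lemma weight_zero : G.weight 0 = 1 := by simp [weight]

lemma weight_add (p q : Fin k → ℕ) : G.weight (p + q) = G.weight p * G.weight q := by
  simp [weight, pow_add, Finset.prod_mul_distrib]

lemma weight_single (i : Fin k) : G.weight (Pi.single i 1) = G.m i := by
  simp [weight, Pi.single_apply, pow_ite]

lemma weight_nsmul (n : ℕ) (p : Fin k → ℕ) : G.weight (n • p) = G.weight p ^ n := by
  simp [weight, pow_mul', Finset.prod_pow]

lemma card_word (p : Fin k → ℕ) : (Fintype.card (G.Word p) : ℝ) = G.weight p := by
  induction p using degree_induction with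
  | zero => rw [weight_zero, Fintype.card_unique, Nat.cast_one]
  | single_add i p ih =>
    rw [← Fintype.card_congr (G.wordMul (Pi.single i 1) p), Fintype.card_prod, Nat.cast_mul, ih,
      weight_add, weight_single]
    congr 2

variable {G}

lemma weight_pos (hm : ∀ i, 0 < G.m i) (p : Fin k → ℕ) : 0 < G.weight p :=
  Finset.prod_pos fun i _ => pow_pos (Nat.cast_pos.2 (hm i)) _

lemma one_lt_weight (hm : ∀ i, 1 < G.m i) {p : Fin k → ℕ} (hp : p ≠ 0) : 1 < G.weight p := by
  have one_lt_m : ∀ i, (1 : ℝ) < G.m i := fun i => Nat.one_lt_cast.2 (hm i)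
  obtain ⟨i, hi⟩ := Function.ne_iff.1 hp
  have h := Finset.prod_lt_prod (s := Finset.univ) (f := fun _ => (1 : ℝ))
    (fun _ _ => one_pos) (fun j _ => one_le_pow₀ (one_lt_m j).le)
    ⟨i, Finset.mem_univ i, one_lt_pow₀ (one_lt_m i) hi⟩
  rwa [Finset.prod_const_one] at h

end Words

section LittlePullback

variable {G}

lemma mem_minExt_iff_of_disjoint {u v x y : Λ} (huv : Disjoint (G.d u) (G.d v)) :
    (x, y) ∈ G.minExt u v ↔ u * x = v * y ∧ G.d x = G.d v := by
  rw [minExt, Set.mem_ofPred_eq, G.d_mul, ← add_eq_sup_of_disjoint huv, add_right_inj]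

lemma subsingleton_minExt_comm {u v : Λ} :
    (G.minExt u v).Subsingleton ↔ (G.minExt v u).Subsingleton := by
  have swap : ∀ {u v x y : Λ}, (x, y) ∈ G.minExt u v → (y, x) ∈ G.minExt v u :=
    fun ⟨h, hd⟩ => ⟨h.symm, by rw [← h, hd, sup_comm]⟩
  exact ⟨fun h _ hx _ hy => Prod.swap_injective (h (swap hx) (swap hy)),
    fun h _ hx _ hy => Prod.swap_injective (h (swap hx) (swap hy))⟩

lemma exists_mem_minExt_of_mem_minExt_mul {u₁ u₂ v x y : Λ}
    (huv : Disjoint (G.d (u₁ * u₂)) (G.d v)) (h : (x, y) ∈ G.minExt (u₁ * u₂) v) :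
    ∃ z y₁ y₂, y = y₁ * y₂ ∧ G.d z = G.d v ∧ (z, y₁) ∈ G.minExt u₁ v ∧
      (x, y₂) ∈ G.minExt u₂ z := by
  obtain ⟨hxy, hx⟩ := (mem_minExt_iff_of_disjoint huv).1 h
  rw [G.d_mul] at huv
  have hy : G.d y = G.d u₁ + G.d u₂ := by
    have hd := congrArg G.d hxy
    rw [G.d_mul, G.d_mul, G.d_mul, hx, add_comm] at hd
    exact (add_left_cancel hd).symm
  obtain ⟨y₁, y₂, rfl, hy₁, hy₂⟩ := G.exists_eq_mul_of_d_eq_add hy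
  obtain ⟨z, t, hzt, hz, -⟩ := G.exists_eq_mul_of_d_eq_add (w := u₂ * x) (p := G.d v)
    (q := G.d u₂) (by rw [G.d_mul, hx, add_comm])
  rw [mul_assoc, hzt, ← mul_assoc, ← mul_assoc] at hxy
  obtain ⟨h₁, rfl⟩ := G.eq_and_eq_of_mul_eq_mul hxy (by rw [G.d_mul, G.d_mul, hz, hy₁, add_comm])
  have h₁v : Disjoint (G.d u₁) (G.d v) := huv.mono_left le_self_add
  have h₂z : Disjoint (G.d u₂) (G.d z) := hz ▸ huv.mono_left le_add_self
  exact ⟨z, y₁, t, rfl, hz, (mem_minExt_iff_of_disjoint h₁v).2 ⟨h₁, hz⟩,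
    (mem_minExt_iff_of_disjoint h₂z).2 ⟨hzt, hx.trans hz.symm⟩⟩

lemma subsingleton_minExt_mul {u₁ u₂ v : Λ} (huv : Disjoint (G.d (u₁ * u₂)) (G.d v))
    (h₁ : (G.minExt u₁ v).Subsingleton)
    (h₂ : ∀ z, G.d z = G.d v → (G.minExt u₂ z).Subsingleton) :
    (G.minExt (u₁ * u₂) v).Subsingleton := by
  rintro ⟨x, y⟩ h ⟨x', y'⟩ h'
  obtain ⟨z, y₁, y₂, rfl, hz, hzy, hx⟩ := exists_mem_minExt_of_mem_minExt_mul huv h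
  obtain ⟨z', y₁', y₂', rfl, -, hzy', hx'⟩ := exists_mem_minExt_of_mem_minExt_mul huv h'
  obtain ⟨rfl, rfl⟩ := Prod.mk.inj (h₁ hzy hzy')
  obtain ⟨rfl, rfl⟩ := Prod.mk.inj (h₂ z hz hx hx')
  rfl

lemma subsingleton_minExt_one (v : Λ) : (G.minExt 1 v).Subsingleton := by
  have h1v : Disjoint (G.d 1) (G.d v) := by rw [G.d_one]; exact disjoint_bot_left
  have eq_one : ∀ {x y}, (x, y) ∈ G.minExt 1 v → x = v ∧ y = 1 := fun {x y} h => by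
    obtain ⟨hxy, hx⟩ := (mem_minExt_iff_of_disjoint h1v).1 h
    obtain ⟨rfl, h1⟩ := G.eq_and_eq_of_mul_eq_mul (a := x) (b := 1) (by simpa using hxy) hx
    exact ⟨rfl, h1.symm⟩
  rintro ⟨x, y⟩ h ⟨x', y'⟩ h'
  obtain ⟨rfl, rfl⟩ := eq_one h
  obtain ⟨rfl, rfl⟩ := eq_one h'
  rfl

lemma LittlePullback.subsingleton_minExt_edge (hG : G.LittlePullback) {i : Fin k} (e : G.Edge i)
    (v : Λ) (hev : Disjoint (G.d e) (G.d v)) : (G.minExt e v).Subsingleton := by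
  rw [subsingleton_minExt_comm]
  induction v using G.edge_induction generalizing e with
  | h1 => exact subsingleton_minExt_one _
  | hmul j f w ih =>
    have hef := hev
    rw [G.d_mul] at hef
    have hij : i ≠ j := by
      rintro rfl
      simpa [e.2, f.2] using Pi.disjoint_iff.1 (hef.mono_right le_self_add) i
    refine subsingleton_minExt_mul hev.symm ?_ fun z hz => ?_
    · exact Set.encard_le_one_iff_subsingleton.1 (hG j i hij.symm f e)
    · exact ih ⟨z, hz.trans e.2⟩ ((hef.mono_right le_add_self).mono_left hz.le)

lemma LittlePullback.subsingleton_minExt (hG : G.LittlePullback) (u v : Λ)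
    (huv : Disjoint (G.d u) (G.d v)) : (G.minExt u v).Subsingleton := by
  induction u using G.edge_induction generalizing v with
  | h1 => exact subsingleton_minExt_one v
  | hmul i e w ih =>
    have hew := huv
    rw [G.d_mul] at hew
    exact subsingleton_minExt_mul huv (hG.subsingleton_minExt_edge e v (hew.mono_left le_self_add))
      fun z hz => ih z (hz ▸ hew.mono_left le_add_self)

lemma exists_mem_minExt_of_mul_eq_mul {u v a β y z : Λ} (huv : Disjoint (G.d u) (G.d v))
    (ha : G.d a = G.d u) (h : v * (a * β) * y = u * (a * β) * z) :
    ∃ c, (c, a) ∈ G.minExt u v ∧ c * β * y = a * β * z := by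
  have hle : G.d v ≤ G.d (a * β * z) := by
    have hd : G.d v ≤ G.d u + G.d (a * β * z) := by
      rw [← G.d_mul, ← mul_assoc, ← h, mul_assoc, G.d_mul]
      exact le_self_add
    refine le_of_add_le_add_left (a := G.d u) ?_
    rw [add_eq_sup_of_disjoint huv]
    exact sup_le le_self_add hd
  obtain ⟨c, t, hct, hc⟩ := G.exists_eq_mul_of_le_d hle
  have hvu : v * a * (β * y) = u * c * t := by
    rw [mul_assoc u c, ← hct]
    simpa only [mul_assoc] using h
  obtain ⟨h₁, rfl⟩ := G.eq_and_eq_of_mul_eq_mul hvu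
    (by rw [G.d_mul, G.d_mul, ha, hc, add_comm])
  exact ⟨c, (mem_minExt_iff_of_disjoint huv).2 ⟨h₁.symm, hc⟩, by rw [hct, mul_assoc]⟩

/-- The two prefixes of degree `d(u)` agree by uniqueness of minimal common extensions, and
cancelling them reproduces the situation for the remaining words of degree `n d(u)`. -/
lemma LittlePullback.eq_of_common_extension (hG : G.LittlePullback) (n : ℕ) {u v α α' : Λ}
    (huv : Disjoint (G.d u) (G.d v)) (hα : G.d α = n • G.d u) (hα' : G.d α' = n • G.d u)
    (h : ∃ y z, v * α * y = u * α * z) (h' : ∃ y z, v * α' * y = u * α' * z) : α = α' := by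
  induction n generalizing u v α α' with
  | zero =>
    rw [zero_smul] at hα hα'
    rw [G.eq_one_of_d_eq_zero hα, G.eq_one_of_d_eq_zero hα']
  | succ n ih =>
    rw [succ_nsmul'] at hα hα'
    obtain ⟨a, β, rfl, ha, hβ⟩ := G.exists_eq_mul_of_d_eq_add hα
    obtain ⟨a', β', rfl, ha', hβ'⟩ := G.exists_eq_mul_of_d_eq_add hα'
    obtain ⟨y, z, hyz⟩ := h
    obtain ⟨y', z', hyz'⟩ := h'
    obtain ⟨c, hca, hβyz⟩ := exists_mem_minExt_of_mul_eq_mul huv ha hyz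
    obtain ⟨c', hca', hβyz'⟩ := exists_mem_minExt_of_mul_eq_mul huv ha' hyz'
    obtain ⟨rfl, rfl⟩ := Prod.mk.inj (hG.subsingleton_minExt u v huv hca hca')
    have hc : G.d c = G.d v := ((mem_minExt_iff_of_disjoint huv).1 hca).2
    rw [ih (u := a) (v := c) (by rwa [ha, hc]) (by rw [hβ, ha]) (by rw [hβ', ha]) ⟨y, z, hβyz⟩
      ⟨y', z', hβyz'⟩]

end LittlePullback

namespace IsCuntzType

variable {G} {A : Type v} [Ring A] [StarRing A] {S : Λ →* A}

lemma star_mul_map_mul (hS : G.IsCuntzType S) (a b : Λ) : star (S a) * S (a * b) = S b := by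
  rw [map_mul, ← mul_assoc, hS.isometry, one_mul]

lemma star_map_mul_mul (hS : G.IsCuntzType S) (a b : Λ) :
    star (S (a * b)) * S a = star (S b) := by
  rw [map_mul, star_mul, mul_assoc, hS.isometry, mul_one]

lemma star_mul_eq_zero (hS : G.IsCuntzType S) {a b : Λ} (hd : G.d a = G.d b) (hne : a ≠ b) :
    star (S a) * S b = 0 := by
  induction a using G.edge_induction generalizing b with
  | h1 => exact absurd (G.eq_one_of_d_eq_zero (by rw [← hd, G.d_one])).symm hne
  | hmul i e w ih =>
    rw [G.d_mul, e.2] at hd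
    obtain ⟨f, b', rfl, hf, hb'⟩ := G.exists_eq_mul_of_d_eq_add hd.symm
    rw [map_mul, star_mul, mul_assoc]
    obtain rfl | hef := eq_or_ne (e : Λ) f
    · rw [hS.star_mul_map_mul]
      exact ih hb'.symm fun h => hne (by rw [h])
    · rw [map_mul, ← mul_assoc (star (S e)),
        hS.star_mul_of_ne i e ⟨f, hf⟩ fun h => hef (congrArg Subtype.val h), zero_mul, mul_zero]

lemma sum_word (hS : G.IsCuntzType S) (p : Fin k → ℕ) :
    ∑ w : G.Word p, S w * star (S w) = 1 := by
  induction p using degree_induction with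
  | zero =>
    rw [Fintype.sum_unique, G.eq_one_of_d_eq_zero (default : G.Word 0).2, map_one, star_one,
      one_mul]
  | single_add i p ih =>
    calc ∑ w : G.Word (Pi.single i 1 + p), S w * star (S w)
        = ∑ e : G.Edge i, ∑ w : G.Word p, S (e * w) * star (S (e * w)) := by
          rw [← (G.wordMul (Pi.single i 1) p).sum_comp, Fintype.sum_prod_type]
          simp only [wordMul_coe]
      _ = ∑ e : G.Edge i, S e * (∑ w : G.Word p, S w * star (S w)) * star (S e) := by
          simp only [map_mul, star_mul, Finset.mul_sum, Finset.sum_mul, mul_assoc]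
      _ = 1 := by simp only [ih, mul_one, hS.sum_mul_star i]

lemma exists_mul_eq_mul_of_star_mul_ne_zero (hS : G.IsCuntzType S) {a b : Λ}
    (h : star (S a) * S b ≠ 0) : ∃ y z, a * y = b * z := by
  have hsum : star (S a) * S b = ∑ y : G.Word (G.d b), S y * (star (S (a * y)) * S b) := by
    rw [← one_mul (star (S a) * S b), ← hS.sum_word (G.d b), Finset.sum_mul]
    simp only [map_mul, star_mul, mul_assoc]
  rw [hsum] at h
  obtain ⟨y, -, hy⟩ := Finset.exists_ne_zero_of_sum_ne_zero h
  obtain ⟨b', z, hbz, hb'⟩ := G.exists_eq_mul_of_le_d (w := a * y) (p := G.d b)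
    (by rw [G.d_mul, y.2]; exact le_add_self)
  obtain rfl | hbb := eq_or_ne b' b
  · exact ⟨y, z, hbz⟩
  · rw [hbz, map_mul, star_mul, mul_assoc, hS.star_mul_eq_zero hb' hbb, mul_zero, mul_zero] at hy
    exact absurd rfl hy

end IsCuntzType

section Monomials

/-- The monomial `s_u s_v^*`. -/
noncomputable def mono (u v : Λ) : G.Alg := G.s u * star (G.s v)

lemma mono_one_one : G.mono 1 1 = 1 := by simp [mono]

lemma norm_s_le (w : Λ) : ‖G.s w‖ ≤ 1 :=
  lp.norm_le_of_forall_le zero_le_one fun R => R.norm_le w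

lemma mono_mul_mono (u v w : Λ) : G.mono u v * G.mono v w = G.mono u w := by
  rw [mono, mono, mul_assoc, ← mul_assoc (star (G.s v)), G.s_isCuntzType.isometry, one_mul, mono]

lemma sum_mono_self (p : Fin k → ℕ) : ∑ w : G.Word p, G.mono w w = 1 := G.s_isCuntzType.sum_word p

lemma mono_eq_sum_mono_mul (u v : Λ) (p : Fin k → ℕ) :
    G.mono u v = ∑ w : G.Word p, G.mono (u * w) (v * w) := by
  calc G.mono u v = G.s u * (∑ w : G.Word p, G.mono w w) * star (G.s v) := by
        rw [sum_mono_self, mul_one, mono]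
    _ = _ := by simp only [mono, map_mul, star_mul, Finset.mul_sum, Finset.sum_mul, mul_assoc]

lemma mono_mul_s_mem_span (u v w : Λ) :
    G.mono u v * G.s w ∈ Submodule.span ℂ (Set.range fun x : Λ × Λ => G.mono x.1 x.2) := by
  rw [G.mono_eq_sum_mono_mul u v (G.d w), Finset.sum_mul]
  refine Submodule.sum_mem _ fun g _ => ?_
  obtain ⟨f, y, hfy, hf⟩ := G.exists_eq_mul_of_le_d (w := v * g) (p := G.d w)
    (by rw [G.d_mul, g.2]; exact le_add_self)
  rw [hfy, mono, mul_assoc]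
  obtain rfl | hne := eq_or_ne f w
  · rw [G.s_isCuntzType.star_map_mul_mul]
    exact Submodule.subset_span ⟨(u * g, y), rfl⟩
  · rw [map_mul G.s f, star_mul, mul_assoc, G.s_isCuntzType.star_mul_eq_zero hf hne, mul_zero,
      mul_zero]
    exact zero_mem _

lemma mono_mul_star_s_mem_span (u v w : Λ) :
    G.mono u v * star (G.s w) ∈ Submodule.span ℂ (Set.range fun x : Λ × Λ => G.mono x.1 x.2) :=
  Submodule.subset_span ⟨(u, w * v), by simp only [mono, map_mul, star_mul, mul_assoc]⟩

lemma dense_adjoin_range_s : Dense (StarAlgebra.adjoin ℂ (Set.range G.s) : Set G.Alg) := by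
  have himage : (Subtype.val : G.Alg → G.BoundedFamilies) '' StarAlgebra.adjoin ℂ (Set.range G.s) =
      StarAlgebra.adjoin ℂ (Set.range G.univRep) := by
    have hmap := G.algSub.subtype.map_adjoin (Set.range G.s)
    rw [← Set.range_comp] at hmap
    exact congrArg SetLike.coe hmap
  refine Subtype.dense_iff.2 ?_
  erw [himage]
  exact subset_rfl

lemma adjoin_range_s_le_span_mono (a : G.Alg) (ha : a ∈ StarAlgebra.adjoin ℂ (Set.range G.s)) :
    a ∈ Submodule.span ℂ (Set.range fun x : Λ × Λ => G.mono x.1 x.2) := by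
  set V := Submodule.span ℂ (Set.range fun x : Λ × Λ => G.mono x.1 x.2)
  have mul_mem_of_mono : ∀ b, (∀ u v, G.mono u v * b ∈ V) → ∀ x ∈ V, x * b ∈ V := fun b hb x hx =>
    (Submodule.span_le (p := V.comap (LinearMap.mulRight ℂ b))).2
      (by rintro _ ⟨y, rfl⟩; exact hb _ _) hx
  suffices h : ∀ x ∈ V, x * a ∈ V by
    simpa using h 1 (Submodule.subset_span ⟨(1, 1), G.mono_one_one⟩)
  change a ∈ Algebra.adjoin ℂ _ at ha
  induction ha using Algebra.adjoin_induction with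
  | mem y hy =>
    rcases hy with ⟨w, rfl⟩ | ⟨w, hw⟩
    · exact mul_mem_of_mono _ fun u v => G.mono_mul_s_mem_span u v w
    · rw [← star_star y, ← hw]
      exact mul_mem_of_mono _ fun u v => G.mono_mul_star_s_mem_span u v w
  | algebraMap r =>
    intro x hx
    rw [Algebra.algebraMap_eq_smul_one, mul_smul_comm, mul_one]
    exact V.smul_mem r hx
  | add y z _ _ hy hz => intro x hx; rw [mul_add]; exact V.add_mem (hy x hx) (hz x hx)
  | mul y z _ _ hy hz => intro x hx; rw [← mul_assoc]; exact hz _ (hy x hx)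

lemma dense_span_mono :
    Dense (Submodule.span ℂ (Set.range fun x : Λ × Λ => G.mono x.1 x.2) : Set G.Alg) :=
  G.dense_adjoin_range_s.mono G.adjoin_range_s_le_span_mono

lemma clm_ext {E : Type*} [NormedAddCommGroup E] [NormedSpace ℂ E] {f g : G.Alg →L[ℂ] E}
    (h : ∀ u v, f (G.mono u v) = g (G.mono u v)) : f = g :=
  ContinuousLinearMap.ext_on G.dense_span_mono <| by
    rintro _ ⟨x, rfl⟩
    exact h _ _

end Monomials

section States

open scoped ComplexOrder InnerProductSpace

/-- A state: a positive linear functional with `φ(1) = 1`. -/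
structure IsState {A : Type*} [Ring A] [StarRing A] [Algebra ℂ A] (φ : A →ₗ[ℂ] ℂ) : Prop where
  map_one : φ 1 = 1
  nonneg : ∀ a, 0 ≤ φ (star a * a)

variable {A : Type*} [CStarAlgebra A]

lemma IsState.norm_le {φ : A →ₗ[ℂ] ℂ} (hφ : IsState φ) (a : A) : ‖φ a‖ ≤ ‖a‖ := by
  let _ := CStarAlgebra.spectralOrder A
  have := CStarAlgebra.spectralOrderedRing A
  let f : A →ₚ[ℂ] ℂ := PositiveLinearMap.mk₀ φ fun x hx => by
    obtain ⟨b, rfl⟩ := CStarAlgebra.nonneg_iff_eq_star_mul_self.1 hx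
    exact hφ.nonneg b
  set ξ := f.toPreGNS 1
  have hξ : ‖ξ‖ = 1 := by
    have h : f 1 = 1 := hφ.map_one
    rw [f.preGNS_norm_def]
    simp [ξ, h]
  have inner_eq : φ a = ⟪ξ, f.leftMulMapPreGNS a ξ⟫_ℂ := by
    rw [f.preGNS_inner_def]
    simp only [f.leftMulMapPreGNS_apply, ξ, f.ofPreGNS_toPreGNS, star_one, one_mul, mul_one]
    rfl
  calc ‖φ a‖ ≤ ‖ξ‖ * ‖f.leftMulMapPreGNS a ξ‖ := inner_eq ▸ norm_inner_le_norm _ _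
    _ ≤ ‖ξ‖ * (‖a‖ * ‖ξ‖) := by
      gcongr
      exact (f.leftMulMapPreGNS a).le_of_opNorm_le
        (LinearMap.mkContinuous_norm_le _ (norm_nonneg a) _) ξ
    _ = ‖a‖ := by rw [hξ, one_mul, mul_one]

/-- A state of a C*-algebra as a continuous functional. -/
noncomputable def IsState.toCLM {φ : A →ₗ[ℂ] ℂ} (hφ : IsState φ) : A →L[ℂ] ℂ :=
  φ.mkContinuous 1 fun a => by rw [one_mul]; exact hφ.norm_le a

@[simp] lemma IsState.toCLM_apply {φ : A →ₗ[ℂ] ℂ} (hφ : IsState φ) (a : A) :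
    hφ.toCLM a = φ a := rfl

lemma exists_isState_of_starAlgHom {E : Type*} [NormedAddCommGroup E] [InnerProductSpace ℂ E]
    [CompleteSpace E] (π : A →⋆ₐ[ℂ] (E →L[ℂ] E)) {ξ : E} (hξ : ‖ξ‖ = 1) :
    ∃ φ : A →ₗ[ℂ] ℂ, IsState φ := by
  refine ⟨{ toFun := fun a => ⟪ξ, π a ξ⟫_ℂ
            map_add' := fun a b => by simp
            map_smul' := fun c a => by simp }, ?_, fun a => ?_⟩
  · simp [hξ]
  · change 0 ≤ ⟪ξ, π (star a * a) ξ⟫_ℂ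
    rw [map_mul, map_star, ContinuousLinearMap.star_eq_adjoint]
    change 0 ≤ ⟪ξ, ContinuousLinearMap.adjoint (π a) (π a ξ)⟫_ℂ
    rw [ContinuousLinearMap.adjoint_inner_right,
      inner_self_eq_norm_sq_to_K]
    exact pow_nonneg (RCLike.ofReal_nonneg.2 (norm_nonneg _)) 2

lemma exists_limit_state {T : Type*} (l : Filter T) [l.NeBot] (f : T → A →ₗ[ℂ] ℂ)
    (hf : ∀ t, IsState (f t)) :
    ∃ φ : A →ₗ[ℂ] ℂ, IsState φ ∧ ∀ a b, (∀ᶠ t in l, f t a = f t b) → φ a = φ b := by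
  let U := Ultrafilter.of l
  have exists_limit : ∀ a, ∃ z, Filter.Tendsto (fun t => f t a) U (nhds z) := fun a => by
    obtain ⟨z, -, hz⟩ := (isCompact_closedBall (0 : ℂ) ‖a‖).ultrafilter_le_nhds
      (U.map fun t => f t a) (Filter.le_principal_iff.2 <| Filter.mem_map.2 <|
        Filter.univ_mem' fun t => mem_closedBall_zero_iff.2 ((hf t).norm_le a))
    exact ⟨z, hz⟩
  choose L hL using exists_limit
  refine ⟨{ toFun := L
            map_add' := fun a b => tendsto_nhds_unique (hL (a + b)) <| by
              simpa only [map_add] using (hL a).add (hL b)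
            map_smul' := fun c a => tendsto_nhds_unique (hL (c • a)) <| by
              simpa only [map_smul, RingHom.id_apply] using (hL a).const_smul c },
    ⟨?_, fun a => ?_⟩, fun a b hab => ?_⟩
  · exact tendsto_nhds_unique (hL 1) (by simp only [(hf _).map_one]; exact tendsto_const_nhds)
  · exact ge_of_tendsto (hL _) (Filter.Eventually.of_forall fun t => (hf t).nonneg a)
  · exact tendsto_nhds_unique_of_eventuallyEq (hL a) (hL b) (Ultrafilter.of_le l hab)

lemma IsTracialState.isState {A : Type*} [Ring A] [StarRing A] [Algebra ℂ A] {φ : A →ₗ[ℂ] ℂ}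
    (hφ : IsTracialState φ) : IsState φ where
  map_one := hφ.map_one
  nonneg a := Complex.nonneg_iff.2 ⟨hφ.re_nonneg a, (hφ.im_eq_zero a).symm⟩

lemma IsState.isTracialState_comp {A B : Type*} [Ring A] [StarRing A] [Algebra ℂ A] [Ring B]
    [StarRing B] [Algebra ℂ B] {φ : A →ₗ[ℂ] ℂ} (hφ : IsState φ) (π : B →⋆ₐ[ℂ] A)
    (h : ∀ a b, φ (π a * π b) = φ (π b * π a)) :
    IsTracialState (φ.comp (π : B →ₗ[ℂ] A)) where
  map_one := by simp [hφ.map_one]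
  re_nonneg a := by simpa [map_star] using (Complex.nonneg_iff.1 (hφ.nonneg (π a))).1
  im_eq_zero a := by simpa [map_star] using (Complex.nonneg_iff.1 (hφ.nonneg (π a))).2.symm
  tracial a b := by simpa using h a b

end States

section Representation

/-- For every colour `i`, each point of `X` is `e • x` for a unique edge `e` of colour `i` and a
unique point `x`, so that `Λ` acts on an orthonormal basis indexed by `X` by operators of Cuntz
type. -/
def IsCuntzAction (X : Type*) [MulAction Λ X] : Prop :=
  ∀ i, Function.Bijective fun x : G.Edge i × X => (x.1 : Λ) • x.2

namespace IsCuntzAction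

variable {G} {X : Type*} [MulAction Λ X]

lemma smul_injective (hX : G.IsCuntzAction X) (w : Λ) : Function.Injective fun x : X => w • x := by
  induction w using G.edge_induction with
  | h1 => exact fun x y h => by simpa only [one_smul] using h
  | hmul i e w ih =>
    intro x y h
    simp only [mul_smul] at h
    exact ih (Prod.ext_iff.1 ((hX i).1 (a₁ := (e, w • x)) (a₂ := (e, w • y)) h)).2

variable {E : Type*} [NormedAddCommGroup E] [InnerProductSpace ℂ E] [CompleteSpace E]

lemma exists_isometric_rep (hX : G.IsCuntzAction X) (b : HilbertBasis X ℂ E) :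
    ∃ S : Λ →* (E →L[ℂ] E), (∀ w x, S w (b x) = b (w • x)) ∧ ∀ w ξ, ‖S w ξ‖ = ‖ξ‖ := by
  choose V hV using fun w : Λ => exists_linearIsometry_apply_hilbertBasis b
    (b.orthonormal.comp (w • ·) (hX.smul_injective w))
  refine ⟨{ toFun := fun w => (V w).toContinuousLinearMap
            map_one' := clm_ext_hilbertBasis b fun x => ?_
            map_mul' := fun w w' => clm_ext_hilbertBasis b fun x => ?_ },
    hV, fun w => (V w).norm_map⟩
  · exact (hV 1 x).trans (congrArg b (one_smul Λ x))
  · change V (w * w') (b x) = V w (V w' (b x))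
    simp only [hV, Function.comp_apply, mul_smul]

lemma isCuntzType (hX : G.IsCuntzAction X) (b : HilbertBasis X ℂ E) {S : Λ →* (E →L[ℂ] E)}
    (hS : ∀ w x, S w (b x) = b (w • x)) (hS' : ∀ w ξ, ‖S w ξ‖ = ‖ξ‖) : G.IsCuntzType S := by
  have star_apply_of_ne :
      ∀ {i} {e f : G.Edge i}, e ≠ f → ∀ x, star (S e) (b ((f : Λ) • x)) = 0 := by
    intro i e f hne x
    refine ext_inner_hilbertBasis b fun y => ?_
    rw [ContinuousLinearMap.star_eq_adjoint, ContinuousLinearMap.adjoint_inner_right, hS,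
      inner_zero_right]
    exact b.orthonormal.2 fun h =>
      hne (Prod.ext_iff.1 ((hX i).1 (a₁ := (e, y)) (a₂ := (f, x)) h)).1
  have star_mul_self : ∀ w, star (S w) * S w = 1 := fun w =>
    (ContinuousLinearMap.norm_map_iff_adjoint_comp_self (S w)).1 (hS' w)
  have star_apply : ∀ w x, star (S w) (b (w • x)) = b x := fun w x => by
    rw [← hS]
    exact DFunLike.congr_fun (star_mul_self w) (b x)
  refine ⟨fun i e => star_mul_self e, fun i e f hne => clm_ext_hilbertBasis b fun x => ?_,
    fun i => clm_ext_hilbertBasis b fun y => ?_⟩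
  · change star (S e) (S f (b x)) = 0
    rw [hS, star_apply_of_ne hne]
  · obtain ⟨⟨f, x⟩, rfl⟩ := (hX i).2 y
    rw [sum_apply, Finset.sum_eq_single f]
    · change S f (star (S f) (b ((f : Λ) • x))) = b ((f : Λ) • x)
      rw [star_apply, hS]
    · intro e _ hne
      change S e (star (S e) (b ((f : Λ) • x))) = 0
      rw [star_apply_of_ne hne, map_zero]
    · exact fun h => absurd (Finset.mem_univ f) h

end IsCuntzAction

lemma exists_isState_of_isCuntzAction {X : Type*} [MulAction Λ X] [Nonempty X]
    (hX : G.IsCuntzAction X) : ∃ φ : G.Alg →ₗ[ℂ] ℂ, IsState φ := by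
  let b : HilbertBasis X ℂ (lp (fun _ : X => ℂ) 2) := .ofRepr (.refl ℂ _)
  obtain ⟨S, hS, hS'⟩ := hX.exists_isometric_rep b
  obtain ⟨π, -, -⟩ := G.existsUnique_lift S (hX.isCuntzType b hS hS')
  obtain ⟨x⟩ := ‹Nonempty X›
  exact exists_isState_of_starAlgHom π (b.orthonormal.1 x)

/-- The relation `u c^{-a} = v c^{-b}` on `Λ × ℕ`, stated without inverses. -/
def tailSetoid (c : Λ) : Setoid (Λ × ℕ) where
  r x y := x.1 * c ^ y.2 = y.1 * c ^ x.2
  iseqv :=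
    { refl := fun _ => rfl
      symm := Eq.symm
      trans := by
        rintro ⟨u, a⟩ ⟨v, b⟩ ⟨w, n⟩ huv hvw
        dsimp only at huv hvw ⊢
        refine G.eq_of_mul_eq_mul_right (b := c ^ b) ?_
        calc u * c ^ n * c ^ b = u * c ^ b * c ^ n := by
              rw [mul_assoc, mul_assoc, pow_mul_comm]
          _ = v * c ^ n * c ^ a := by
              rw [huv, mul_assoc, mul_assoc, pow_mul_comm]
          _ = w * c ^ a * c ^ b := by
              rw [hvw, mul_assoc, mul_assoc, pow_mul_comm] }

/-- The inductive limit of `Λ` along right multiplication by `c`: the set of formal fractions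
`u c^{-n}`, on which `Λ` acts by left multiplication. -/
def Tail (c : Λ) : Type u := Quotient (G.tailSetoid c)

namespace Tail

instance (c : Λ) : Nonempty (G.Tail c) := ⟨Quotient.mk _ (1, 0)⟩

instance mulAction (c : Λ) : MulAction Λ (G.Tail c) where
  smul w := Quotient.map (sa := G.tailSetoid c) (sb := G.tailSetoid c)
      (fun x => (w * x.1, x.2)) <| by
    intro x y h
    change w * x.1 * c ^ y.2 = w * y.1 * c ^ x.2
    rw [mul_assoc, mul_assoc]
    exact congrArg (w * ·) h
  one_smul x := by
    induction x using Quotient.inductionOn with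
    | _ x => exact congrArg (Quotient.mk _) (Prod.ext (one_mul x.1) rfl)
  mul_smul w w' x := by
    induction x using Quotient.inductionOn with
    | _ x => exact congrArg (Quotient.mk _) (Prod.ext (mul_assoc w w' x.1) rfl)

lemma isCuntzAction {c : Λ} (hc : ∀ i, Pi.single i 1 ≤ G.d c) : G.IsCuntzAction (G.Tail c) := by
  refine fun i => ⟨?_, fun y => ?_⟩
  · rintro ⟨e, ⟨x⟩⟩ ⟨f, ⟨y⟩⟩ h
    have heq : e * x.1 * c ^ y.2 = f * y.1 * c ^ x.2 := Quotient.exact h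
    rw [mul_assoc, mul_assoc] at heq
    obtain ⟨hef, hxy⟩ := G.eq_and_eq_of_mul_eq_mul heq (e.2.trans f.2.symm)
    exact Prod.ext (Subtype.ext hef) (Quotient.sound hxy)
  · induction y using Quotient.inductionOn with
    | _ y =>
      obtain ⟨e, x, h, he⟩ := G.exists_eq_mul_of_le_d (w := y.1 * c) (p := Pi.single i 1)
        ((hc i).trans (by rw [G.d_mul]; exact le_add_self))
      refine ⟨(⟨e, he⟩, Quotient.mk _ (x, y.2 + 1)), Quotient.sound ?_⟩
      change e * x * c ^ y.2 = y.1 * c ^ (y.2 + 1)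
      rw [← h, mul_assoc, ← pow_succ']

end Tail

lemma exists_d_eq {G : SingleVertexKGraph k Λ} (hm : ∀ i, 0 < G.m i) (p : Fin k → ℕ) :
    ∃ w, G.d w = p := by
  have hcard : 0 < Fintype.card (G.Word p) := by
    exact_mod_cast (G.card_word p).symm ▸ weight_pos hm p
  obtain ⟨w⟩ := Fintype.card_pos_iff.1 hcard
  exact ⟨w, w.2⟩

lemma exists_isState (hm : ∀ i, 0 < G.m i) : ∃ φ : G.Alg →ₗ[ℂ] ℂ, IsState φ := by
  obtain ⟨c, hc⟩ := exists_d_eq hm 1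
  refine G.exists_isState_of_isCuntzAction (Tail.isCuntzAction G (c := c) fun i => ?_)
  rw [hc]
  exact update_le_iff.2 ⟨le_rfl, fun _ _ => zero_le_one⟩

end Representation

section CentralState

open scoped ComplexOrder

/-- The average of the functionals `a ↦ ψ (s_w^* a s_w)` over the words `w` of degree `p`. -/
noncomputable def averaged (ψ : G.Alg →ₗ[ℂ] ℂ) (p : Fin k → ℕ) : G.Alg →ₗ[ℂ] ℂ :=
  (G.weight p : ℂ)⁻¹ • ∑ w : G.Word p,
    ψ ∘ₗ LinearMap.mulRight ℂ (G.s w) ∘ₗ LinearMap.mulLeft ℂ (star (G.s w))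

lemma averaged_apply (ψ : G.Alg →ₗ[ℂ] ℂ) (p : Fin k → ℕ) (a : G.Alg) :
    G.averaged ψ p a = (G.weight p : ℂ)⁻¹ * ∑ w : G.Word p, ψ (star (G.s w) * a * G.s w) := by
  simp [averaged]

variable {G}

lemma IsState.averaged (hm : ∀ i, 0 < G.m i) {ψ : G.Alg →ₗ[ℂ] ℂ} (hψ : IsState ψ)
    (p : Fin k → ℕ) : IsState (G.averaged ψ p) where
  map_one := by
    have hcard : (Fintype.card (G.Word p) : ℂ) = G.weight p := by exact_mod_cast G.card_word p
    simp only [averaged_apply, mul_one, G.s_isCuntzType.isometry, hψ.map_one, Finset.sum_const,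
      Finset.card_univ, nsmul_eq_mul, hcard]
    exact inv_mul_cancel₀ (Complex.ofReal_ne_zero.2 (G.weight_pos hm p).ne')
  nonneg a := by
    rw [averaged_apply]
    refine mul_nonneg (inv_nonneg.2 (Complex.zero_le_real.2 (G.weight_pos hm p).le))
      (Finset.sum_nonneg fun w _ => ?_)
    simpa only [star_mul, mul_assoc] using hψ.nonneg (a * G.s w)

variable (G)

lemma averaged_mono_mul (ψ : G.Alg →ₗ[ℂ] ℂ) {p : Fin k → ℕ} (u v : G.Word p) (b : G.Alg) :
    G.averaged ψ p (G.mono u v * b) = (G.weight p : ℂ)⁻¹ * ψ (star (G.s v) * b * G.s u) := by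
  rw [averaged_apply, Finset.sum_eq_single u _ (by simp)]
  · rw [mono, mul_assoc (G.s u), ← mul_assoc (star (G.s u)), G.s_isCuntzType.isometry, one_mul]
  · intro w _ hw
    rw [mono, mul_assoc (G.s u), ← mul_assoc (star (G.s w)), G.s_isCuntzType.star_mul_eq_zero
      (w.2.trans u.2.symm) (Subtype.coe_injective.ne hw), zero_mul, zero_mul, map_zero]

lemma averaged_mul_mono (ψ : G.Alg →ₗ[ℂ] ℂ) {p : Fin k → ℕ} (u v : G.Word p) (b : G.Alg) :
    G.averaged ψ p (b * G.mono u v) = (G.weight p : ℂ)⁻¹ * ψ (star (G.s v) * b * G.s u) := by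
  rw [averaged_apply, Finset.sum_eq_single v _ (by simp)]
  · simp only [mono, mul_assoc, G.s_isCuntzType.isometry, mul_one]
  · intro w _ hw
    simp only [mono, mul_assoc, G.s_isCuntzType.star_mul_eq_zero (v.2.trans w.2.symm)
      (Subtype.coe_injective.ne hw.symm), mul_zero, map_zero]

lemma averaged_mono_mul_comm (ψ : G.Alg →ₗ[ℂ] ℂ) {u v : Λ} (huv : G.d u = G.d v)
    {p : Fin k → ℕ} (hp : G.d u ≤ p) (b : G.Alg) :
    G.averaged ψ p (G.mono u v * b) = G.averaged ψ p (b * G.mono u v) := by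
  rw [G.mono_eq_sum_mono_mul u v (p - G.d u), Finset.sum_mul, Finset.mul_sum, map_sum, map_sum]
  refine Finset.sum_congr rfl fun w _ => ?_
  have hu : G.d (u * w) = p := by rw [G.d_mul, w.2, add_tsub_cancel_of_le hp]
  have hv : G.d (v * w) = p := by rw [G.d_mul, ← huv, ← G.d_mul, hu]
  exact (G.averaged_mono_mul ψ ⟨_, hu⟩ ⟨_, hv⟩ b).trans
    (G.averaged_mul_mono ψ ⟨_, hu⟩ ⟨_, hv⟩ b).symm

lemma exists_isState_forall_mono_mul_comm (hm : ∀ i, 0 < G.m i) :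
    ∃ φ : G.Alg →ₗ[ℂ] ℂ, IsState φ ∧
      ∀ u v, G.d u = G.d v → ∀ b, φ (G.mono u v * b) = φ (b * G.mono u v) := by
  obtain ⟨ψ, hψ⟩ := G.exists_isState hm
  obtain ⟨φ, hφ, h⟩ := exists_limit_state Filter.atTop (G.averaged ψ) (hψ.averaged hm)
  exact ⟨φ, hφ, fun u v huv b => h _ _ <| (Filter.eventually_ge_atTop (G.d u)).mono fun p hp =>
    G.averaged_mono_mul_comm ψ huv hp b⟩

end CentralState

section Gauge

lemma gauge_mono (t : Fin k → Circle) (u v : Λ) :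
    G.gauge t (G.mono u v) = ((G.character t u / G.character t v : Circle) : ℂ) • G.mono u v := by
  rw [mono, map_mul, map_star, gauge_s, gauge_s, star_smul, smul_mul_smul_comm, Circle.coe_div,
    div_eq_mul_inv, ← Circle.coe_inv, Circle.coe_inv_eq_conj]
  rfl

lemma character_exp (x : Fin k → ℝ) (w : Λ) :
    G.character (fun i => Circle.exp (x i)) w = Circle.exp (∑ i, x i * G.d w i) := by
  change ∏ i, Circle.exp (x i) ^ G.d w i = _
  have exp_sum : Circle.exp (∑ i, x i * G.d w i) = ∏ i, Circle.exp (x i * G.d w i) :=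
    congrArg Additive.toMul (map_sum Circle.expHom _ _)
  rw [exp_sum]
  refine Finset.prod_congr rfl fun i _ => ?_
  rw [mul_comm, ← nsmul_eq_mul]
  exact (congrArg Additive.toMul (map_nsmul Circle.expHom (G.d w i) (x i))).symm

lemma gauge_exp_mono (x : Fin k → ℝ) (u v : Λ) :
    G.gauge (fun i => Circle.exp (x i)) (G.mono u v) =
      (Circle.exp (∑ i, x i * G.d u i - ∑ i, x i * G.d v i) : ℂ) • G.mono u v := by
  rw [gauge_mono, character_exp, character_exp, Circle.exp_sub]

lemma gauge_mono_of_d_eq (t : Fin k → Circle) {u v : Λ} (h : G.d u = G.d v) :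
    G.gauge t (G.mono u v) = G.mono u v := by
  have : G.character t u = G.character t v := by
    change ∏ i, t i ^ G.d u i = ∏ i, t i ^ G.d v i
    rw [h]
  rw [gauge_mono, this, div_self', Circle.coe_one, one_smul]

lemma mono_mem_core {u v : Λ} (h : G.d u = G.d v) : G.mono u v ∈ G.core :=
  fun t => G.gauge_mono_of_d_eq t h

lemma exists_gauge_mono_eq_neg {u v : Λ} (h : G.d u ≠ G.d v) :
    ∃ t, G.gauge t (G.mono u v) = -G.mono u v := by
  obtain ⟨i, hi⟩ := Function.ne_iff.1 h
  have hi' : (G.d u i : ℝ) - G.d v i ≠ 0 := sub_ne_zero.2 (by exact_mod_cast hi)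
  refine ⟨fun j => Circle.exp ((Pi.single i (Real.pi / (G.d u i - G.d v i)) : Fin k → ℝ) j), ?_⟩
  rw [gauge_exp_mono]
  simp only [Pi.single_apply, ite_mul, zero_mul, Finset.sum_ite_eq', Finset.mem_univ, if_true]
  rw [← mul_sub, div_mul_cancel₀ _ hi', Circle.coe_exp, Complex.exp_pi_mul_I, neg_one_smul]

lemma core_subset_closure_span : (G.core : Set G.Alg) ⊆ closure (Submodule.span ℂ
    ((fun x : Λ × Λ => G.mono x.1 x.2) '' {x | G.d x.1 = G.d x.2})) := fun _ ha =>
  mem_closure_span_image_of_fixed G.dense_span_mono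
    (fun t a => (norm_starAlgEquiv_apply (G.gauge t) a).le)
    (fun t x => ⟨_, G.gauge_mono t x.1 x.2⟩) (fun _ hx t => G.gauge_mono_of_d_eq t hx)
    (fun _ hx => G.exists_gauge_mono_eq_neg hx) ha

lemma continuous_gauge_apply (a : G.Alg) : Continuous fun t : Fin k → Circle => G.gauge t a := by
  let V : Submodule ℂ G.Alg :=
    { carrier := {x | Continuous fun t => G.gauge t x}
      zero_mem' := by simpa only [Set.mem_ofPred_eq, map_zero] using continuous_const
      add_mem' := fun hx hy => by
        simp only [Set.mem_ofPred_eq, map_add]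
        exact Continuous.add hx hy
      smul_mem' := fun c x hx => by
        simp only [Set.mem_ofPred_eq, map_smul]
        exact Continuous.const_smul hx c }
  have span_le : Submodule.span ℂ (Set.range fun x : Λ × Λ => G.mono x.1 x.2) ≤ V := by
    refine Submodule.span_le.2 ?_
    rintro _ ⟨⟨u, v⟩, rfl⟩
    change Continuous fun t => G.gauge t (G.mono u v)
    have continuous_character : ∀ w : Λ, Continuous fun t => G.character t w := fun w =>
      continuous_finsetProd Finset.univ fun i _ => (continuous_apply i).pow (G.d w i)
    simp only [gauge_mono]
    exact (continuous_subtype_val.comp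
      ((continuous_character u).div' (continuous_character v))).smul continuous_const
  refine continuous_of_uniform_approx_of_continuous fun U hU => ?_
  obtain ⟨ε, hε, hεU⟩ := Metric.mem_uniformity_dist.1 hU
  obtain ⟨x, hx, hax⟩ := Metric.mem_closure_iff.1 (G.dense_span_mono a) ε hε
  refine ⟨_, span_le hx, fun t => hεU ?_⟩
  rwa [dist_eq_norm, ← map_sub, norm_starAlgEquiv_apply, ← dist_eq_norm]

end Gauge

section ModularFlow

variable {G}

lemma log_weight (hm : ∀ i, 0 < G.m i) (p : Fin k → ℕ) :
    Real.log (G.weight p) = ∑ i, Real.log (G.m i) * p i := by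
  rw [weight, Real.log_prod fun i _ => pow_ne_zero _ (Nat.cast_ne_zero.2 (hm i).ne')]
  exact Finset.sum_congr rfl fun i _ => by rw [Real.log_pow, mul_comm]

lemma modularFlow_mono (hm : ∀ i, 0 < G.m i) (t : ℝ) (u v : Λ) :
    G.modularFlow t (G.mono u v) = (Circle.exp
      (t * (Real.log (G.weight (G.d v)) - Real.log (G.weight (G.d u)))) : ℂ) • G.mono u v := by
  have sum_eq : ∀ w : Λ, ∑ i, -(t * Real.log (G.m i)) * (G.d w i : ℝ) =
      -(t * Real.log (G.weight (G.d w))) := fun w => by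
    simp only [log_weight hm, neg_mul, Finset.sum_neg_distrib, Finset.mul_sum, mul_assoc]
  rw [modularFlow, gauge_exp_mono, sum_eq, sum_eq]
  congr 3
  ring

lemma modularFlow_mono_of_weight_eq (hm : ∀ i, 0 < G.m i) (t : ℝ) {u v : Λ}
    (h : G.weight (G.d u) = G.weight (G.d v)) : G.modularFlow t (G.mono u v) = G.mono u v := by
  rw [modularFlow_mono hm, h, sub_self, mul_zero, Circle.exp_zero, Circle.coe_one, one_smul]

lemma exists_modularFlow_mono_eq_neg (hm : ∀ i, 0 < G.m i) {u v : Λ}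
    (h : G.weight (G.d u) ≠ G.weight (G.d v)) :
    ∃ t, G.modularFlow t (G.mono u v) = -G.mono u v := by
  have hlog : Real.log (G.weight (G.d v)) - Real.log (G.weight (G.d u)) ≠ 0 :=
    sub_ne_zero.2 (Real.log_injOn_pos.ne (G.weight_pos hm _) (G.weight_pos hm _) h.symm)
  refine ⟨Real.pi / (Real.log (G.weight (G.d v)) - Real.log (G.weight (G.d u))), ?_⟩
  rw [modularFlow_mono hm, div_mul_cancel₀ _ hlog, Circle.coe_exp, Complex.exp_pi_mul_I,
    neg_one_smul]

lemma modularFixed_subset_closure_span (hm : ∀ i, 0 < G.m i) :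
    (G.modularFixed : Set G.Alg) ⊆ closure (Submodule.span ℂ
      ((fun x : Λ × Λ => G.mono x.1 x.2) '' {x | G.weight (G.d x.1) = G.weight (G.d x.2)})) :=
  fun _ ha => mem_closure_span_image_of_fixed G.dense_span_mono
    (fun t a => (norm_starAlgEquiv_apply (G.modularFlow t) a).le)
    (fun t x => ⟨_, modularFlow_mono hm t x.1 x.2⟩)
    (fun _ hx t => modularFlow_mono_of_weight_eq hm t hx)
    (fun _ hx => exists_modularFlow_mono_eq_neg hm hx) ha

variable (G)

lemma modularFlow_zero (a : G.Alg) : G.modularFlow 0 a = a := by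
  have : (fun i : Fin k => Circle.exp (-(0 * Real.log (G.m i)))) = 1 := by
    funext i
    simp
  rw [modularFlow, this]
  exact DFunLike.congr_fun G.gaugeHom_one a

lemma modularFlow_add (t u : ℝ) (a : G.Alg) :
    G.modularFlow (t + u) a = G.modularFlow t (G.modularFlow u a) := by
  have : (fun i => Circle.exp (-((t + u) * Real.log (G.m i)))) =
      fun i => Circle.exp (-(t * Real.log (G.m i))) * Circle.exp (-(u * Real.log (G.m i))) := by
    funext i
    rw [← Circle.exp_add]
    ring_nf
  rw [modularFlow, this]
  exact (G.gauge_gauge _ _ a).symm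

lemma continuous_modularFlow_apply (a : G.Alg) : Continuous fun t => G.modularFlow t a :=
  (G.continuous_gauge_apply a).comp <| continuous_pi fun _ =>
    Circle.exp.continuous.comp (continuous_id.mul continuous_const).neg

end ModularFlow

section Expectation

open MeasureTheory

open scoped ComplexOrder

lemma integrable_gauge_apply (a : G.Alg) :
    Integrable (fun x : UnitAddTorus (Fin k) => G.gauge (fun i => (x i).toCircle) a)
      (Measure.pi fun _ => AddCircle.haarAddCircle) :=
  ((G.continuous_gauge_apply a).comp <| continuous_pi fun i =>
    AddCircle.continuous_toCircle.comp (continuous_apply i)).integrable_of_hasCompactSupport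
      (HasCompactSupport.of_compactSpace _)

/-- The expectation `Φ₀` as a continuous linear map. -/
noncomputable def expectationCLM : G.Alg →L[ℂ] G.Alg :=
  LinearMap.mkContinuous
    { toFun := G.expectation
      map_add' := fun a b => by
        simp only [expectation, map_add]
        exact integral_add (G.integrable_gauge_apply a) (G.integrable_gauge_apply b)
      map_smul' := fun c a => by
        simp only [expectation, map_smul]
        exact integral_smul c _ }
    1 fun a => (norm_integral_le_of_norm_le_const (C := ‖a‖) (Filter.Eventually.of_forall fun _ =>
      (norm_starAlgEquiv_apply (G.gauge _) a).le)).trans (by simp)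

lemma expectation_of_mem_core {a : G.Alg} (ha : a ∈ G.core) : G.expectation a = a := by
  have gauge_a : ∀ t, G.gauge t a = a := ha
  simp [expectation, gauge_a]

lemma expectation_mono_of_ne {u v : Λ} (h : G.d u ≠ G.d v) : G.expectation (G.mono u v) = 0 := by
  obtain ⟨c, hc⟩ : ∃ c : ℂ, G.expectation (G.mono u v) = c • G.mono u v := by
    simp only [expectation, gauge_mono]
    exact ⟨_, integral_smul_const _ _⟩
  obtain ⟨t, ht⟩ := G.exists_gauge_mono_eq_neg h
  have fixed : G.gauge t (c • G.mono u v) = c • G.mono u v := hc ▸ G.expectation_mem_core _ t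
  rw [map_smul, ht, smul_neg, neg_eq_iff_add_eq_zero, ← two_smul ℂ,
    smul_eq_zero_iff_right two_ne_zero] at fixed
  rw [hc, fixed]

variable {G}

lemma IsState.comp_expectation {φ : G.Alg →ₗ[ℂ] ℂ} (hφ : IsState φ) :
    IsState (φ ∘ₗ (G.expectationCLM : G.Alg →ₗ[ℂ] G.Alg)) where
  map_one := (congrArg φ (G.expectation_of_mem_core (one_mem _))).trans hφ.map_one
  nonneg a := by
    change 0 ≤ hφ.toCLM (G.expectation (star a * a))
    rw [expectation, ← hφ.toCLM.integral_comp_comm (G.integrable_gauge_apply _)]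
    refine integral_nonneg fun x => ?_
    simpa only [map_mul, map_star, hφ.toCLM_apply, Pi.zero_apply] using
      hφ.nonneg (G.gauge (fun i => (x i).toCircle) a)

end Expectation

section FixedPoints

variable {A : Type*} [CStarAlgebra A]

lemma isClosed_fixedPoints {T : Type*} (α : T → A ≃⋆ₐ[ℂ] A) :
    IsClosed (fixedPoints α : Set A) := by
  have : (fixedPoints α : Set A) = ⋂ t, {a | α t a = a} := by
    ext a
    simp only [Set.mem_iInter]
    rfl
  rw [this]
  exact isClosed_iInter fun t => isClosed_eq (continuous_starAlgEquiv (α t)) continuous_id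

lemma IsState.ext_of_subset_closure_span {B : StarSubalgebra ℂ A} (_ : IsClosed (B : Set A))
    {s : Set A} (hsB : s ⊆ B) (hBs : (B : Set A) ⊆ closure (Submodule.span ℂ s : Set A))
    {φ ψ : B →ₗ[ℂ] ℂ} (hφ : IsState φ) (hψ : IsState ψ)
    (h : ∀ a : B, (a : A) ∈ s → φ a = ψ a) : φ = ψ :=
  LinearMap.ext fun a => DFunLike.congr_fun (ContinuousLinearMap.ext_on
    (dense_span_preimage_coe hsB hBs) (f := hφ.toCLM) (g := hψ.toCLM) h) a

lemma IsState.isTracialState_comp_subtype {φ : A →ₗ[ℂ] ℂ} (hφ : IsState φ)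
    {B : StarSubalgebra ℂ A} {s : Set A}
    (hBs : (B : Set A) ⊆ closure (Submodule.span ℂ s : Set A))
    (h : ∀ x ∈ s, ∀ b, φ (x * b) = φ (b * x)) :
    IsTracialState (φ ∘ₗ B.subtype.toLinearMap) :=
  hφ.isTracialState_comp B.subtype fun a b =>
    apply_mul_comm_of_mem_closure_span hφ.toCLM (fun x hx => h x hx b) (hBs a.2)

end FixedPoints

variable {G}

section Traces

variable {B : StarSubalgebra ℂ G.Alg} {φ : B →ₗ[ℂ] ℂ}

lemma IsTracialState.map_mono_mul_of_ne (hφ : IsTracialState φ) (hB : G.core ≤ B) {a b u v : Λ}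
    (hd : G.d a = G.d b) (hne : a ≠ b) (h : G.mono (a * u) (b * v) ∈ B) :
    φ ⟨G.mono (a * u) (b * v), h⟩ = 0 := by
  let x : B := ⟨G.mono (a * u) (b * v), h⟩
  let q : B := ⟨G.mono b b, hB (G.mono_mem_core rfl)⟩
  have x_mul_q : x * q = x := Subtype.ext <| by
    change G.mono (a * u) (b * v) * G.mono b b = G.mono (a * u) (b * v)
    rw [mono, mono, mul_assoc, ← mul_assoc (star _), G.s_isCuntzType.star_map_mul_mul,
      ← star_mul, ← map_mul]
  have q_mul_x : q * x = 0 := Subtype.ext <| by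
    change G.mono b b * G.mono (a * u) (b * v) = 0
    rw [mono, mono, map_mul G.s a, mul_assoc, mul_assoc, ← mul_assoc (star (G.s b)),
      G.s_isCuntzType.star_mul_eq_zero hd.symm hne.symm, zero_mul, mul_zero]
  calc φ x = φ (x * q) := by rw [x_mul_q]
    _ = φ (q * x) := hφ.tracial x q
    _ = 0 := by rw [q_mul_x, map_zero]

lemma IsTracialState.map_mono_of_ne (hφ : IsTracialState φ) (hB : G.core ≤ B) {u v : Λ}
    (hd : G.d u = G.d v) (hne : u ≠ v) (h : G.mono u v ∈ B) : φ ⟨G.mono u v, h⟩ = 0 := by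
  simpa only [mul_one] using
    hφ.map_mono_mul_of_ne (u := 1) (v := 1) hB hd hne (by simpa only [mul_one] using h)

lemma IsTracialState.map_mono_self (hφ : IsTracialState φ) (hB : G.core ≤ B) (u : Λ)
    (h : G.mono u u ∈ B) : φ ⟨G.mono u u, h⟩ = (G.weight (G.d u) : ℂ)⁻¹ := by
  let e (v w : G.Word (G.d u)) : B := ⟨G.mono v w, hB (G.mono_mem_core (v.2.trans w.2.symm))⟩
  let u' : G.Word (G.d u) := ⟨u, rfl⟩
  have e_mul_e : ∀ v w, e v w * e w v = e v v := fun v w => Subtype.ext (G.mono_mul_mono _ _ _)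
  have map_e : ∀ w, φ (e w w) = φ (e u' u') := fun w => by
    rw [← e_mul_e w u', hφ.tracial, e_mul_e]
  have sum_e : ∑ w, e w w = 1 := Subtype.ext <| by
    rw [AddSubmonoidClass.coe_finsetSum]
    exact G.sum_mono_self _
  have hcard : (Fintype.card (G.Word (G.d u)) : ℂ) = G.weight (G.d u) := by
    exact_mod_cast G.card_word _
  refine eq_inv_of_mul_eq_one_right ?_
  calc (G.weight (G.d u) : ℂ) * φ (e u' u') = ∑ w, φ (e w w) := by
        simp only [map_e, Finset.sum_const, Finset.card_univ, nsmul_eq_mul, hcard]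
    _ = 1 := by rw [← map_sum, sum_e, hφ.map_one]

lemma IsTracialState.map_mono_eq_of_d_eq (hφ : IsTracialState φ) {ψ : B →ₗ[ℂ] ℂ}
    (hψ : IsTracialState ψ) (hB : G.core ≤ B) {u v : Λ} (hd : G.d u = G.d v)
    (h : G.mono u v ∈ B) : φ ⟨G.mono u v, h⟩ = ψ ⟨G.mono u v, h⟩ := by
  obtain rfl | hne := eq_or_ne u v
  · rw [hφ.map_mono_self hB, hψ.map_mono_self hB]
  · rw [hφ.map_mono_of_ne hB hd hne, hψ.map_mono_of_ne hB hd hne]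

lemma IsTracialState.eq_of_core {φ ψ : G.core →ₗ[ℂ] ℂ} (hφ : IsTracialState φ)
    (hψ : IsTracialState ψ) : φ = ψ := by
  refine IsState.ext_of_subset_closure_span (isClosed_fixedPoints _)
    ?_ G.core_subset_closure_span hφ.isState hψ.isState ?_
  · rintro _ ⟨x, hx, rfl⟩
    exact G.mono_mem_core hx
  · rintro ⟨_, h⟩ ⟨x, hx, rfl⟩
    exact hφ.map_mono_eq_of_d_eq hψ le_rfl hx h

end Traces

section GaugeTrace

/-- The functional `ω` takes the values of `τ ∘ Φ₀` on the monomials: it vanishes on `s_u s_v^*`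
for `u ≠ v`, and its value on `s_u s_u^*` is `m^{-d(u)}`. -/
structure IsGaugeTrace (ω : G.Alg →L[ℂ] ℂ) : Prop where
  map_mono_self : ∀ u, ω (G.mono u u) = (G.weight (G.d u) : ℂ)⁻¹
  map_mono_of_ne : ∀ u v, u ≠ v → ω (G.mono u v) = 0

lemma IsState.isGaugeTrace_comp_expectation {φ : G.Alg →ₗ[ℂ] ℂ} (hφ : IsState φ)
    (hτ : IsTracialState (φ ∘ₗ G.core.subtype.toLinearMap)) :
    IsGaugeTrace hφ.comp_expectation.toCLM where
  map_mono_self u :=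
    (congrArg φ (G.expectation_of_mem_core (G.mono_mem_core rfl))).trans
      (hτ.map_mono_self le_rfl u (G.mono_mem_core rfl))
  map_mono_of_ne u v h := by
    by_cases hd : G.d u = G.d v
    · exact (congrArg φ (G.expectation_of_mem_core (G.mono_mem_core hd))).trans
        (hτ.map_mono_of_ne le_rfl hd h (G.mono_mem_core hd))
    · exact (congrArg φ (G.expectation_mono_of_ne hd)).trans (map_zero φ)

namespace IsGaugeTrace

variable {ω : G.Alg →L[ℂ] ℂ}

lemma map_gauge (hω : IsGaugeTrace ω) (t : Fin k → Circle) (a : G.Alg) :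
    ω (G.gauge t a) = ω a := by
  let γ : G.Alg →L[ℂ] G.Alg :=
    { toFun := G.gauge t, map_add' := map_add _, map_smul' := map_smul _
      cont := continuous_starAlgEquiv (G.gauge t) }
  have : ω ∘L γ = ω := G.clm_ext fun u v => by
    change ω (G.gauge t (G.mono u v)) = ω (G.mono u v)
    obtain rfl | hne := eq_or_ne u v
    · rw [G.gauge_mono_of_d_eq t rfl]
    · rw [gauge_mono, map_smul, hω.map_mono_of_ne u v hne, smul_zero]
  exact DFunLike.congr_fun this a

lemma map_s_mul_mono_mul (hω : IsGaugeTrace ω) {w f : Λ} (hd : G.d f = G.d w) (x y : Λ) :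
    ω (G.s w * G.mono x (f * y)) =
      (G.weight (G.d w) : ℂ)⁻¹ * ω (G.mono x (f * y) * G.s w) := by
  have s_mul_mono : G.s w * G.mono x (f * y) = G.mono (w * x) (f * y) := by
    rw [mono, mono, ← mul_assoc, ← map_mul]
  rw [s_mul_mono]
  obtain rfl | hne := eq_or_ne f w
  · have mono_mul_s : G.mono x (f * y) * G.s f = G.mono x y := by
      rw [mono, mul_assoc, G.s_isCuntzType.star_map_mul_mul, mono]
    rw [mono_mul_s]
    obtain rfl | hxy := eq_or_ne x y
    · rw [hω.map_mono_self, hω.map_mono_self, G.d_mul, weight_add, Complex.ofReal_mul, mul_inv]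
    · rw [hω.map_mono_of_ne _ _ hxy, mul_zero,
        hω.map_mono_of_ne _ _ fun h => hxy (G.eq_of_mul_eq_mul_left h)]
  · have mono_mul_s : G.mono x (f * y) * G.s w = 0 := by
      rw [mono, map_mul, star_mul, mul_assoc, mul_assoc, G.s_isCuntzType.star_mul_eq_zero hd hne,
        mul_zero, mul_zero]
    rw [mono_mul_s, map_zero, mul_zero]
    exact hω.map_mono_of_ne _ _ fun h => hne (G.eq_and_eq_of_mul_eq_mul h hd.symm).1.symm

lemma map_s_mul (hω : IsGaugeTrace ω) (w : Λ) (b : G.Alg) :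
    ω (G.s w * b) = (G.weight (G.d w) : ℂ)⁻¹ * ω (b * G.s w) := by
  have : ω ∘L ContinuousLinearMap.mul ℂ G.Alg (G.s w) = (G.weight (G.d w) : ℂ)⁻¹ •
      ω ∘L (ContinuousLinearMap.mul ℂ G.Alg).flip (G.s w) := by
    refine G.clm_ext fun x y => ?_
    change ω (G.s w * G.mono x y) = (G.weight (G.d w) : ℂ)⁻¹ * ω (G.mono x y * G.s w)
    rw [G.mono_eq_sum_mono_mul x y (G.d w), Finset.mul_sum, Finset.sum_mul, map_sum, map_sum,
      Finset.mul_sum]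
    refine Finset.sum_congr rfl fun g _ => ?_
    obtain ⟨f, y', hfy, hf⟩ := G.exists_eq_mul_of_le_d (w := y * g) (p := G.d w)
      (by rw [G.d_mul, g.2]; exact le_add_self)
    rw [hfy]
    exact hω.map_s_mul_mono_mul hf _ _
  exact DFunLike.congr_fun this b

lemma map_mul_star_s (hω : IsGaugeTrace ω) (w : Λ) (b : G.Alg) :
    ω (b * star (G.s w)) = (G.weight (G.d w) : ℂ)⁻¹ * ω (star (G.s w) * b) := by
  let w' : G.Word (G.d w) := ⟨w, rfl⟩
  calc ω (b * star (G.s w))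
      = ∑ f : G.Word (G.d w), ω (G.s f * (star (G.s f) * (b * star (G.s w)))) := by
        rw [← map_sum]
        simp only [← mul_assoc]
        rw [← Finset.sum_mul, ← Finset.sum_mul, G.s_isCuntzType.sum_word, one_mul]
    _ = ∑ f : G.Word (G.d w),
          (G.weight (G.d w) : ℂ)⁻¹ * ω (star (G.s f) * b * (star (G.s w) * G.s f)) :=
        Finset.sum_congr rfl fun f _ => by rw [hω.map_s_mul, f.2]; simp only [mul_assoc]
    _ = (G.weight (G.d w) : ℂ)⁻¹ * ω (star (G.s w) * b) := by
        rw [Finset.sum_eq_single w' _ (by simp), G.s_isCuntzType.isometry, mul_one]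
        intro f _ hf
        rw [G.s_isCuntzType.star_mul_eq_zero f.2.symm (Subtype.coe_injective.ne hf.symm), mul_zero,
          map_zero, mul_zero]

lemma map_mono_mul (hm : ∀ i, 0 < G.m i) (hω : IsGaugeTrace ω) (u v : Λ) (b : G.Alg) :
    ω (G.mono u v * b) = (G.weight (G.d v) / G.weight (G.d u) : ℂ) * ω (b * G.mono u v) := by
  have hv : (G.weight (G.d v) : ℂ) ≠ 0 := Complex.ofReal_ne_zero.2 (G.weight_pos hm _).ne'
  rw [mono, mul_assoc, hω.map_s_mul, ← mul_assoc b, hω.map_mul_star_s, mul_assoc (star (G.s v))]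
  field_simp

lemma map_mono_mul_comm (hm : ∀ i, 0 < G.m i) (hω : IsGaugeTrace ω) {u v : Λ}
    (h : G.weight (G.d u) = G.weight (G.d v)) (b : G.Alg) :
    ω (G.mono u v * b) = ω (b * G.mono u v) := by
  rw [hω.map_mono_mul hm, h, div_self (Complex.ofReal_ne_zero.2 (G.weight_pos hm _).ne'), one_mul]

end IsGaugeTrace

end GaugeTrace

section ModularGroup

lemma isStripFunction_exp_mul (l : ℝ) (c : ℂ) :
    IsStripFunction fun z => Complex.exp (z * l * Complex.I) * c where
  diffContOnCl := Differentiable.diffContOnCl (by fun_prop)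
  bounded := by
    refine ⟨Real.exp |l| * ‖c‖, fun z h0 h1 => ?_⟩
    have hre : (z * l * Complex.I).re = z.im * -l := by simp
    rw [norm_mul, Complex.norm_exp, hre]
    gcongr
    calc z.im * -l ≤ z.im * |l| := by gcongr; exact neg_le_abs l
      _ ≤ |l| := mul_le_of_le_one_left (abs_nonneg l) h1

lemma IsGaugeTrace.isKMSFunction_mono (hm : ∀ i, 0 < G.m i) {ω : G.Alg →L[ℂ] ℂ}
    (hω : IsGaugeTrace ω) (u v : Λ) (b : G.Alg) :
    IsKMSFunction ω G.modularFlow (G.mono u v) b fun z => Complex.exp (z * ((Real.log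
      (G.weight (G.d v)) - Real.log (G.weight (G.d u)) : ℝ) : ℂ) * Complex.I) *
        ω (G.mono u v * b) where
  toIsStripFunction := isStripFunction_exp_mul _ _
  apply_ofReal t := by
    rw [modularFlow_mono hm, smul_mul_assoc, map_smul, Circle.coe_exp, smul_eq_mul,
      Complex.ofReal_mul]
  apply_ofReal_add_I t := by
    have hu := G.weight_pos hm (G.d u)
    have hv := G.weight_pos hm (G.d v)
    have hu' : (G.weight (G.d u) : ℂ) ≠ 0 := Complex.ofReal_ne_zero.2 hu.ne'
    have hv' : (G.weight (G.d v) : ℂ) ≠ 0 := Complex.ofReal_ne_zero.2 hv.ne'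
    set l := Real.log (G.weight (G.d v)) - Real.log (G.weight (G.d u)) with hl
    have exp_neg : Complex.exp (-l) = G.weight (G.d u) / G.weight (G.d v) := by
      rw [← Complex.ofReal_neg, ← Complex.ofReal_exp, hl, neg_sub, Real.exp_sub, Real.exp_log hu,
        Real.exp_log hv, Complex.ofReal_div]
    have arg_eq : ((t : ℂ) + Complex.I) * l * Complex.I = (t * l : ℝ) * Complex.I + -l := by
      push_cast
      linear_combination (l : ℂ) * Complex.I_mul_I
    rw [modularFlow_mono hm, ← hl, mul_smul_comm, map_smul, Circle.coe_exp, smul_eq_mul, arg_eq,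
      Complex.exp_add, exp_neg, hω.map_mono_mul hm]
    field_simp

lemma IsGaugeTrace.isModularGroup (hm : ∀ i, 0 < G.m i) {ω : G.Alg →L[ℂ] ℂ}
    (hω : IsGaugeTrace ω) : IsModularGroup ω G.modularFlow where
  map_zero := G.modularFlow_zero
  map_add := G.modularFlow_add
  continuous := G.continuous_modularFlow_apply
  invariant t a := hω.map_gauge _ a
  kms a b := by
    obtain ⟨F, hF⟩ := IsKMSFunction.exists_of_mem_closure_span (Set.range_nonempty _)
      (by rintro _ ⟨x, rfl⟩; exact ⟨_, hω.isKMSFunction_mono hm x.1 x.2 b⟩) (G.dense_span_mono a)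
    exact ⟨F, hF.diffContOnCl, hF.bounded, fun t => ⟨hF.apply_ofReal t, hF.apply_ofReal_add_I t⟩⟩

end ModularGroup

section Compression

lemma IsTracialState.of_apply_eq {A B : Type*} [Ring A] [StarRing A] [Algebra ℂ A] [Ring B]
    [StarRing B] [Algebra ℂ B] {φ : A →ₗ[ℂ] ℂ} (hφ : IsTracialState φ) (π : B →⋆ₙₐ[ℂ] A) {c : ℝ}
    (hc : 0 ≤ c) {ψ : B →ₗ[ℂ] ℂ} (h : ∀ b, ψ b = c * φ (π b)) (map_one : ψ 1 = 1) :
    IsTracialState ψ where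
  map_one := map_one
  re_nonneg b := by
    rw [h, map_mul, map_star, Complex.re_ofReal_mul]
    exact mul_nonneg hc (hφ.re_nonneg _)
  im_eq_zero b := by
    rw [h, map_mul, map_star, Complex.im_ofReal_mul, hφ.im_eq_zero, mul_zero]
  tracial a b := by rw [h, h, map_mul π, map_mul π, hφ.tracial]

lemma coe_character_mul_star (t : Fin k → Circle) (w : Λ) :
    (G.character t w : ℂ) * star (G.character t w : ℂ) = 1 := by
  rw [Complex.star_def, ← Circle.coe_inv_eq_conj, ← Circle.coe_mul, mul_inv_cancel, Circle.coe_one]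

lemma gauge_s_mul_mul_star_s (t : Fin k → Circle) (w : Λ) (a : G.Alg) :
    G.gauge t (G.s w * a * star (G.s w)) = G.s w * G.gauge t a * star (G.s w) := by
  rw [map_mul, map_mul, map_star, gauge_s, star_smul, smul_mul_assoc, smul_mul_smul_comm,
    coe_character_mul_star, one_smul]

lemma gauge_star_s_mul_mul_s (t : Fin k → Circle) (w : Λ) (a : G.Alg) :
    G.gauge t (star (G.s w) * a * G.s w) = star (G.s w) * G.gauge t a * G.s w := by
  rw [map_mul, map_mul, map_star, gauge_s, star_smul, smul_mul_assoc, smul_mul_smul_comm,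
    mul_comm, coe_character_mul_star, one_smul]

lemma s_mul_mul_star_s_mem_modularFixed {a : G.Alg} (ha : a ∈ G.modularFixed) (w : Λ) :
    G.s w * a * star (G.s w) ∈ G.modularFixed := fun t => by
  rw [modularFlow, gauge_s_mul_mul_star_s, ← modularFlow, ha t]

lemma star_s_mul_mul_s_mem_modularFixed {a : G.Alg} (ha : a ∈ G.modularFixed) (w : Λ) :
    star (G.s w) * a * G.s w ∈ G.modularFixed := fun t => by
  rw [modularFlow, gauge_star_s_mul_mul_s, ← modularFlow, ha t]

variable (G) in
/-- The non-unital endomorphism `a ↦ s_w a s_w^*` of the fixed point algebra of the modular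
flow. -/
noncomputable def conjS (w : Λ) : G.modularFixed →⋆ₙₐ[ℂ] G.modularFixed where
  toFun a := ⟨G.s w * a * star (G.s w), s_mul_mul_star_s_mem_modularFixed a.2 w⟩
  map_zero' := Subtype.ext (by simp)
  map_add' a b := Subtype.ext (by simp [mul_add, add_mul])
  map_smul' c a := Subtype.ext (by simp)
  map_mul' a b := Subtype.ext <| by
    change G.s w * (a * b) * star (G.s w) =
      G.s w * a * star (G.s w) * (G.s w * b * star (G.s w))
    simp only [mul_assoc]
    rw [← mul_assoc (star (G.s w)), G.s_isCuntzType.isometry, one_mul]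
  map_star' a := Subtype.ext (by simp [mul_assoc])

/-- The functional `a ↦ m^{d(w)} φ(s_w a s_w^*)`, normalised so that it is again a tracial state
when `φ` is one. -/
noncomputable def compression (φ : G.modularFixed →ₗ[ℂ] ℂ) (w : Λ) : G.modularFixed →ₗ[ℂ] ℂ where
  toFun a := (G.weight (G.d w) : ℂ) * φ (G.conjS w a)
  map_add' a b := by rw [map_add, map_add, mul_add]
  map_smul' c a := by rw [map_smul, map_smul, smul_eq_mul, mul_left_comm]; rfl

lemma compression_apply (φ : G.modularFixed →ₗ[ℂ] ℂ) (w : Λ) (a : G.modularFixed) :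
    compression φ w a = (G.weight (G.d w) : ℂ) * φ (G.conjS w a) := rfl

variable {φ : G.modularFixed →ₗ[ℂ] ℂ}

lemma IsTracialState.compression (hm : ∀ i, 0 < G.m i) (hφ : IsTracialState φ) (w : Λ) :
    IsTracialState (compression φ w) := by
  refine hφ.of_apply_eq (G.conjS w) (G.weight_pos hm (G.d w)).le (compression_apply φ w) ?_
  have conj_one : G.conjS w 1 = ⟨G.mono w w, G.core_le_modularFixed (G.mono_mem_core rfl)⟩ :=
    Subtype.ext (congrArg (· * star (G.s w)) (mul_one (G.s w)))
  rw [compression_apply, conj_one, hφ.map_mono_self G.core_le_modularFixed,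
    mul_inv_cancel₀ (Complex.ofReal_ne_zero.2 (G.weight_pos hm _).ne')]

lemma IsTracialState.eq_sum_compression (hm : ∀ i, 0 < G.m i) (hφ : IsTracialState φ)
    (p : Fin k → ℕ) (a : G.modularFixed) :
    φ a = (G.weight p : ℂ)⁻¹ * ∑ w : G.Word p, SingleVertexKGraph.compression φ w
      ⟨star (G.s w) * a * G.s w, star_s_mul_mul_s_mem_modularFixed a.2 w⟩ := by
  have hp : (G.weight p : ℂ) ≠ 0 := Complex.ofReal_ne_zero.2 (G.weight_pos hm p).ne'
  let P (w : G.Word p) : G.modularFixed :=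
    ⟨G.mono w w, G.core_le_modularFixed (G.mono_mem_core rfl)⟩
  have P_mul_P : ∀ w, P w * P w = P w := fun w => Subtype.ext (G.mono_mul_mono _ _ _)
  have sum_P : ∑ w, P w = 1 := Subtype.ext <| by
    rw [AddSubmonoidClass.coe_finsetSum]
    exact G.sum_mono_self p
  have map_mul_P : ∀ w, φ (a * P w) = φ (P w * (a * P w)) := fun w => by
    rw [hφ.tracial (P w), mul_assoc, P_mul_P]
  have P_mul_mul_P : ∀ w : G.Word p, P w * (a * P w) =
      G.conjS w ⟨star (G.s w) * a * G.s w, star_s_mul_mul_s_mem_modularFixed a.2 w⟩ := fun w =>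
    Subtype.ext <| by
      change G.s w * star (G.s w) * ((a : G.Alg) * (G.s w * star (G.s w))) =
        G.s w * (star (G.s w) * (a : G.Alg) * G.s w) * star (G.s w)
      simp only [mul_assoc]
  calc φ a = ∑ w, φ (a * P w) := by rw [← map_sum, ← Finset.mul_sum, sum_P, mul_one]
    _ = _ := by
      simp only [map_mul_P, P_mul_mul_P, compression_apply, fun w : G.Word p => w.2,
        ← Finset.mul_sum, inv_mul_cancel_left₀ hp]

lemma norm_star_s_mul_mul_s_le (w : Λ) (a : G.Alg) : ‖star (G.s w) * a * G.s w‖ ≤ ‖a‖ :=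
  calc ‖star (G.s w) * a * G.s w‖ ≤ ‖G.s w‖ * ‖a‖ * ‖G.s w‖ := by
        simpa only [norm_star] using norm_mul₃_le (a := star (G.s w)) (b := a) (c := G.s w)
    _ ≤ 1 * ‖a‖ * 1 := by gcongr <;> exact G.norm_s_le w
    _ = ‖a‖ := by rw [one_mul, mul_one]

lemma IsTracialState.norm_le_of_subsingleton (hm : ∀ i, 0 < G.m i) (hφ : IsTracialState φ)
    {p : Fin k → ℕ} {a : G.modularFixed}
    (ha : {w : G.Word p | star (G.s w) * a * G.s w ≠ 0}.Subsingleton) :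
    ‖φ a‖ ≤ (G.weight p)⁻¹ * ‖a‖ := by
  have : IsClosed (G.modularFixed : Set G.Alg) := isClosed_fixedPoints _
  let x (w : G.Word p) : G.modularFixed :=
    ⟨star (G.s w) * a * G.s w, star_s_mul_mul_s_mem_modularFixed a.2 w⟩
  have norm_sum_le : ‖∑ w : G.Word p, SingleVertexKGraph.compression φ w (x w)‖ ≤ ‖a‖ := by
    by_cases h : ∃ w, x w ≠ 0
    · obtain ⟨w, hw⟩ := h
      rw [Finset.sum_eq_single w _ (by simp)]
      · exact ((hφ.compression hm w).isState.norm_le _).trans (norm_star_s_mul_mul_s_le _ _)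
      · intro w' _ hne
        have : x w' = 0 := by
          by_contra hw'
          exact hne (ha (fun h => hw' (Subtype.ext h)) fun h => hw (Subtype.ext h))
        rw [this, map_zero]
    · push Not at h
      simp only [h, map_zero, Finset.sum_const_zero, norm_zero, norm_nonneg]
  rw [hφ.eq_sum_compression hm p, norm_mul, norm_inv, Complex.norm_real,
    Real.norm_of_nonneg (G.weight_pos hm p).le]
  exact mul_le_mul_of_nonneg_left norm_sum_le (inv_nonneg.2 (G.weight_pos hm p).le)

end Compression

section LittlePullback

lemma exists_of_star_s_mul_mono_mul_s_ne_zero {n : ℕ} {u v w : Λ}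
    (hw : G.d w = (n + 1) • G.d u) (h : star (G.s w) * G.mono u v * G.s w ≠ 0) :
    ∃ α, w = u * α ∧ G.d α = n • G.d u ∧ ∃ y z, v * α * y = u * α * z := by
  obtain ⟨u', α, rfl, hu', hα⟩ :=
    G.exists_eq_mul_of_d_eq_add (w := w) (p := G.d u) (by rw [hw, succ_nsmul'])
  have mul_star_mul_ne : star (G.s (u' * α)) * G.s u * (star (G.s v) * G.s (u' * α)) ≠ 0 := by
    simpa only [mono, mul_assoc] using h
  obtain ⟨y, z, hyz⟩ :=
    G.s_isCuntzType.exists_mul_eq_mul_of_star_mul_ne_zero (left_ne_zero_of_mul mul_star_mul_ne)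
  obtain rfl : u' = u := (G.eq_and_eq_of_mul_eq_mul ((mul_assoc _ _ _).symm.trans hyz) hu').1
  refine ⟨α, rfl, hα, G.s_isCuntzType.exists_mul_eq_mul_of_star_mul_ne_zero fun h0 => ?_⟩
  rw [G.s_isCuntzType.star_map_mul_mul, ← mul_assoc, ← star_mul, ← map_mul, h0] at mul_star_mul_ne
  exact mul_star_mul_ne rfl

lemma LittlePullback.subsingleton_star_s_mul_mono_mul_s_ne_zero (hG : G.LittlePullback) (n : ℕ)
    {u v : Λ} (huv : Disjoint (G.d u) (G.d v)) :
    {w : G.Word ((n + 1) • G.d u) | star (G.s w) * G.mono u v * G.s w ≠ 0}.Subsingleton := by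
  intro w hw w' hw'
  obtain ⟨α, hwα, hα, hext⟩ := exists_of_star_s_mul_mono_mul_s_ne_zero w.2 hw
  obtain ⟨α', hwα', hα', hext'⟩ := exists_of_star_s_mul_mono_mul_s_ne_zero w'.2 hw'
  exact Subtype.ext <| by
    rw [hwα, hwα', hG.eq_of_common_extension n huv hα hα' hext hext']

variable {φ : G.modularFixed →ₗ[ℂ] ℂ}

lemma IsTracialState.map_mono_of_disjoint (hm : ∀ i, 1 < G.m i) (hG : G.LittlePullback)
    (hφ : IsTracialState φ) {u v : Λ} (huv : Disjoint (G.d u) (G.d v)) (hu : G.d u ≠ 0)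
    (h : G.mono u v ∈ G.modularFixed) : φ ⟨G.mono u v, h⟩ = 0 := by
  have hm' : ∀ i, 0 < G.m i := fun i => zero_lt_one.trans (hm i)
  let x : G.modularFixed := ⟨G.mono u v, h⟩
  set r := (G.weight (G.d u))⁻¹ with hr
  have norm_le (n : ℕ) : ‖φ x‖ ≤ r ^ (n + 1) * ‖x‖ := by
    rw [hr, inv_pow, ← weight_nsmul]
    exact hφ.norm_le_of_subsingleton hm' (hG.subsingleton_star_s_mul_mono_mul_s_ne_zero n huv)
  have tendsto_pow : Filter.Tendsto (fun n : ℕ => r ^ (n + 1)) Filter.atTop (nhds 0) :=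
    (tendsto_pow_atTop_nhds_zero_of_lt_one (inv_nonneg.2 (G.weight_pos hm' _).le)
      (inv_lt_one_of_one_lt₀ (one_lt_weight hm hu))).comp (Filter.tendsto_add_atTop_nat 1)
  have tendsto_bound := tendsto_pow.mul_const ‖x‖
  rw [zero_mul] at tendsto_bound
  exact norm_le_zero_iff.1 (ge_of_tendsto' tendsto_bound norm_le)

lemma eq_zero_of_weight_eq_one (hm : ∀ i, 1 < G.m i) {p : Fin k → ℕ} (h : G.weight p = 1) :
    p = 0 := by
  by_contra hp
  exact (one_lt_weight hm hp).ne' h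

lemma IsTracialState.map_mono_mul_mul_of_disjoint (hm : ∀ i, 1 < G.m i) (hG : G.LittlePullback)
    (hφ : IsTracialState φ) (a : Λ) {u v : Λ} (huv : Disjoint (G.d u) (G.d v)) (hu : G.d u ≠ 0)
    (hw : G.weight (G.d u) = G.weight (G.d v)) (h : G.mono (a * u) (a * v) ∈ G.modularFixed) :
    φ ⟨G.mono (a * u) (a * v), h⟩ = 0 := by
  have hm' : ∀ i, 0 < G.m i := fun i => zero_lt_one.trans (hm i)
  have mono_mem : G.mono u v ∈ G.modularFixed := fun t => modularFlow_mono_of_weight_eq hm' t hw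
  have conj_mono : G.conjS a ⟨G.mono u v, mono_mem⟩ = ⟨G.mono (a * u) (a * v), h⟩ :=
    Subtype.ext <| by
      change G.s a * G.mono u v * star (G.s a) = G.mono (a * u) (a * v)
      simp only [mono, map_mul, star_mul, mul_assoc]
  have compression_eq_zero := (hφ.compression hm' a).map_mono_of_disjoint hm hG huv hu mono_mem
  rw [compression_apply, conj_mono] at compression_eq_zero
  exact (mul_eq_zero.1 compression_eq_zero).resolve_left
    (Complex.ofReal_ne_zero.2 (G.weight_pos hm' _).ne')

lemma IsTracialState.map_mono_of_littlePullback (hm : ∀ i, 1 < G.m i) (hG : G.LittlePullback)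
    (hφ : IsTracialState φ) {u v : Λ} (hw : G.weight (G.d u) = G.weight (G.d v))
    (hd : G.d u ≠ G.d v) (h : G.mono u v ∈ G.modularFixed) : φ ⟨G.mono u v, h⟩ = 0 := by
  obtain ⟨p, hp⟩ : ∃ p, p = G.d u ⊓ G.d v := ⟨_, rfl⟩
  obtain ⟨a, u', rfl, ha⟩ := G.exists_eq_mul_of_le_d (w := u) (p := p) (hp ▸ inf_le_left)
  obtain ⟨b, v', rfl, hb⟩ := G.exists_eq_mul_of_le_d (w := v) (p := p) (hp ▸ inf_le_right)
  obtain rfl | hab := eq_or_ne a b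
  · simp only [G.d_mul] at hp hw hd
    have weight_eq : G.weight (G.d u') = G.weight (G.d v') := by
      rw [weight_add, weight_add] at hw
      exact mul_left_cancel₀ (G.weight_pos (fun i => zero_lt_one.trans (hm i)) _).ne' hw
    have hdisj : Disjoint (G.d u') (G.d v') := disjoint_iff.2 <| by
      funext i
      have := congrFun (ha.trans hp) i
      simp only [Pi.inf_apply, Pi.add_apply] at this ⊢
      change min _ _ = 0
      omega
    have hu' : G.d u' ≠ 0 := fun h0 => by
      rw [h0, weight_zero] at weight_eq
      exact hd (by rw [h0, eq_zero_of_weight_eq_one hm weight_eq.symm])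
    exact hφ.map_mono_mul_mul_of_disjoint hm hG a hdisj hu' weight_eq h
  · exact hφ.map_mono_mul_of_ne G.core_le_modularFixed (ha.trans hb.symm) hab h

end LittlePullback

section Uniqueness

lemma d_eq_of_finrank_intrinsicGroup (hm : ∀ i, 0 < G.m i)
    (h : Module.finrank ℤ G.intrinsicGroup = 0) {u v : Λ}
    (hw : G.weight (G.d u) = G.weight (G.d v)) : G.d u = G.d v := by
  have : Module.Finite ℤ G.intrinsicGroup :=
    Module.Finite.of_injective G.intrinsicGroup.subtype.toIntLinearMap Subtype.val_injective
  have : Subsingleton G.intrinsicGroup := Module.finrank_zero_iff.1 h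
  have sub_mem : (fun i => (G.d u i : ℤ) - G.d v i) ∈ G.intrinsicGroup := by
    change ∏ i, (G.m i : ℝ) ^ ((G.d u i : ℤ) - G.d v i) = 1
    have m_ne_zero : ∀ i, (G.m i : ℝ) ≠ 0 := fun i => Nat.cast_ne_zero.2 (hm i).ne'
    simp only [zpow_sub₀ (m_ne_zero _), zpow_natCast, Finset.prod_div_distrib]
    exact (div_eq_one_iff_eq (G.weight_pos hm _).ne').2 hw
  have sub_eq_zero' := congrArg Subtype.val
    (Subsingleton.elim (⟨_, sub_mem⟩ : G.intrinsicGroup) 0)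
  exact funext fun i => Int.natCast_inj.1 (sub_eq_zero.1 (congrFun sub_eq_zero' i))

lemma IsTracialState.eq_of_modularFixed (hm : ∀ i, 1 < G.m i)
    (h : G.LittlePullback ∨ Module.finrank ℤ G.intrinsicGroup = 0)
    {φ ψ : G.modularFixed →ₗ[ℂ] ℂ} (hφ : IsTracialState φ) (hψ : IsTracialState ψ) : φ = ψ := by
  have hm' : ∀ i, 0 < G.m i := fun i => zero_lt_one.trans (hm i)
  refine IsState.ext_of_subset_closure_span (isClosed_fixedPoints _) ?_
    (modularFixed_subset_closure_span hm') hφ.isState hψ.isState ?_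
  · rintro _ ⟨x, hx, rfl⟩
    exact fun t => modularFlow_mono_of_weight_eq hm' t hx
  · rintro ⟨_, hmem⟩ ⟨x, hx, rfl⟩
    by_cases hd : G.d x.1 = G.d x.2
    · exact hφ.map_mono_eq_of_d_eq hψ G.core_le_modularFixed hd hmem
    · have hG := h.resolve_right fun hrank =>
        hd (d_eq_of_finrank_intrinsicGroup hm' hrank hx)
      exact (hφ.map_mono_of_littlePullback hm hG hx hd hmem).trans
        (hψ.map_mono_of_littlePullback hm hG hx hd hmem).symm

end Uniqueness

end SingleVertexKGraph

theorem mainTheorem3 {k : ℕ} {Λ : Type*} [Monoid Λ] (G : SingleVertexKGraph k Λ)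
    (hm : ∀ i, 1 < G.m i)
    (h : G.LittlePullback ∨ Module.finrank ℤ G.intrinsicGroup = 0) :
    ∃ τ : G.core →ₗ[ℂ] ℂ,
      -- `τ` is the unique tracial state of the core
      (SingleVertexKGraph.IsTracialState τ ∧
        ∀ τ' : G.core →ₗ[ℂ] ℂ, SingleVertexKGraph.IsTracialState τ' → τ' = τ) ∧
      -- `σ` is the modular action of `ω = τ ∘ Φ₀`
      SingleVertexKGraph.IsModularGroup (G.omega τ) G.modularFlow ∧
      -- the fixed point algebra has a unique tracial state, and it extends `τ`
      ∃ ρ : G.modularFixed →ₗ[ℂ] ℂ,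
        SingleVertexKGraph.IsTracialState ρ ∧
        (∀ ρ' : G.modularFixed →ₗ[ℂ] ℂ, SingleVertexKGraph.IsTracialState ρ' → ρ' = ρ) ∧
        ∀ a : G.core,
          ρ (StarSubalgebra.inclusion G.core_le_modularFixed a) = τ a := by
  have hm' : ∀ i, 0 < G.m i := fun i => zero_lt_one.trans (hm i)
  obtain ⟨φ, hφ, φ_mono_mul_comm⟩ := SingleVertexKGraph.exists_isState_forall_mono_mul_comm G hm'
  have hτ := hφ.isTracialState_comp_subtype G.core_subset_closure_span <| by
    rintro _ ⟨x, hx, rfl⟩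
    exact φ_mono_mul_comm x.1 x.2 hx
  have hω := hφ.isGaugeTrace_comp_expectation hτ
  have hρ := hφ.comp_expectation.isTracialState_comp_subtype
    (SingleVertexKGraph.modularFixed_subset_closure_span hm') <| by
      rintro _ ⟨x, hx, rfl⟩
      exact hω.map_mono_mul_comm hm' hx
  exact ⟨_, ⟨hτ, fun τ' hτ' => hτ'.eq_of_core hτ⟩, hω.isModularGroup hm', _, hρ,
    fun ρ' hρ' => hρ'.eq_of_modularFixed hm h hρ,
    fun a => congrArg φ (G.expectation_of_mem_core a.2)⟩
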